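/- For $j=1,2,3$ let $\tau_j$ be in the upper half plane, $E_j=\mathbb C/\langle 1,\tau_j\rangle$, and let $\mathcal L_j\colon E_j\to\mathbb P^1$ be the Legendre function of $E_j$, i.e. the elliptic function of degree two with zeros $\pm\frac14$, poles $\frac{\tau_j}2\pm\frac14$ and $\mathcal L_j(0)=1$. Put $a_j=\mathcal L_j(\frac{\tau_j}2)$, $b_j=\mathcal L_j(\frac{\tau_j}4)$ (so that $b_j^2=a_j$ and $\mathcal L_j$ is branched over $\pm1,\pm a_j$), $b=b_1b_2b_3$ and $$B'=\{\pm1,\ \pm a_i,\ \pm a_ia_j\ (i\ne j),\ \pm a_1a_2a_3\}.$$ In $T=E_1\times E_2\times E_3$ consider the hypersurfaces (the equations being read in homogeneous coordinates of the points $\mathcal L_j(z_j)\in\mathbb P^1$) $$\hat X_\nu:\ \nu_1(\mathcal L_1\mathcal L_2\mathcal L_3+b_1b_2b_3)+\nu_2(b_2b_3\mathcal L_1+b_1\mathcal L_2\mathcal L_3)=0,\qquad \nu=(\nu_1:\nu_2)\in\mathbb P^1,\ \nu\neq(\pm1:1),$$ $$\hat X_\mu:\ \mathcal L_1\mathcal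 L_2\mathcal L_3=\mu,\quad \mu\in\mathbb C\setminus\{0\},\qquad\qquad \hat X_b:\ \mathcal L_1\mathcal L_2\mathcal L_3=b.$$ Let $(\mathbb Z/2)^9=\{(\zeta_1,\eta_1,\epsilon_1,\zeta_2,\eta_2,\epsilon_2,\zeta_3,\eta_3,\epsilon_3)\}$ act on $T$, where on $E_j$ the elements $\zeta_j,\eta_j,\epsilon_j$ act by $z\mapsto -z$, $z\mapsto -z+\frac{\tau_j}2$, $z\mapsto -z+\frac12$ respectively, and let $$\begin{aligned} G_1&=\langle(1,0,0,1,0,0,1,0,0),(0,1,0,1,1,0,1,1,0),(0,0,0,0,0,1,1,0,1)\rangle,\\ G_2&=\langle(1,0,0,0,0,1,1,0,1),(0,0,1,0,0,0,1,0,1),(0,0,0,1,0,1,0,0,1)\rangle,\\ G_3&=\langle(1,0,0,0,0,1,1,0,1),(0,1,0,0,1,0,1,1,0),(0,0,1,1,0,1,1,0,0)\rangle,\\ G_4&=\langle(1,0,1,0,0,1,1,0,0),(0,1,0,0,1,0,1,1,0),(0,0,0,1,0,1,1,0,1)\rangle. \end{aligned}$$ Let $(\hat X,G)$ be one of $(\hat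 X_\nu,G_1)$, $(\hat X_\mu,G_2)$, $(\hat X_b,G_3)$, $(\hat X_b,G_4)$, and assume that no nonzero element of $G$ has a fixed point on $\hat X$ (so that $\hat X/G$ is the quotient model of a regular generalized Burniat type surface). Then: 1) $\hat X_\nu$ is singular if and only if $\nu\in\{(\pm b_1:1),(1:\pm b_1)\}$, and $$\begin{aligned}\operatorname{Sing}(\hat X_\nu)=\ &\{(z_1,\pm\tfrac14,\pm\tfrac14)\mid 2z_1=0,\ \nu_1b_1+\nu_2\mathcal L_1(z_1)=0\}\\ \cup\ &\{(z_1,\tfrac{\tau_2}2\pm\tfrac14,\tfrac{\tau_3}2\pm\tfrac14)\mid 2z_1=0,\ \nu_2b_1+\nu_1\mathcal L_1(z_1)=0\}\end{aligned}$$ (all combinations of signs are allowed). 2) $\hat X_\mu$ is smooth. 3-4) $\hat X_b$ is singular if and only if $b\in B'$, and $\operatorname{Sing}(\hat X_b)=\{(z_1,z_2,z_3)\in\hat X_b\mid 2z_1=2z_2=2z_3=0\}$. In particular, in every case $\hat X$ is either smooth or its singular locus consists of exactly 8 nodes. -/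

import Mathlib

open scoped UpperHalfPlane Topology LinearAlgebra.Projectivization

noncomputable section

namespace Burniat

/-! ### Elliptic curves and their Legendre functions -/

/-- The pair of periods `(1, τ)`. -/
def periods (τ : ℍ) : PeriodPair where
  ω₁ := 1
  ω₂ := (τ : ℂ)
  indep := by
    rw [LinearIndependent.pair_iff]
    intro s t h
    have him := congrArg Complex.im h
    have hre := congrArg Complex.re h
    have hτ : (τ : ℂ).im ≠ 0 := τ.im_ne_zero
    simp only [Complex.add_im, Complex.real_smul, Complex.mul_im, Complex.ofReal_re,
      Complex.ofReal_im, Complex.one_im, Complex.one_re, Complex.zero_im, mul_zero, zero_mul,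
      add_zero, zero_add] at him
    have ht : t = 0 := by
      rcases mul_eq_zero.mp him with h0 | h0
      · exact h0
      · exact absurd h0 hτ
    subst ht
    simpa using hre

/-- The elliptic curve `ℂ / ⟨1, τ⟩`. -/
abbrev E (τ : ℍ) : Type := ℂ ⧸ (periods τ).lattice

/-- The class of a complex number in `ℂ / ⟨1, τ⟩`. -/
def cls (τ : ℍ) (z : ℂ) : E τ := Submodule.Quotient.mk z

/-- The Weierstrass function as a function on `ℂ / ⟨1, τ⟩`
(its value at the pole `0` is a junk value, which is never used below). -/
def wp (τ : ℍ) : E τ → ℂ :=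
  Quotient.lift (periods τ).weierstrassP (by
    intro x y h
    have h' : x - y ∈ (periods τ).lattice := (Submodule.quotientRel_def _).mp h
    simpa using (periods τ).weierstrassP_add_coe y ⟨x - y, h'⟩)

open Classical in
/-- First homogeneous coordinate of the Legendre function `𝓛 : E τ → ℙ¹`, see `legendre`. -/
def legendreNum (τ : ℍ) (x : E τ) : ℂ :=
  if x = 0 then 1 else wp τ x - wp τ (cls τ (1 / 4))

open Classical in
/-- Second homogeneous coordinate of the Legendre function `𝓛 : E τ → ℙ¹`, see `legendre`. -/
def legendreDen (τ : ℍ) (x : E τ) : ℂ :=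
  if x = 0 then 1 else wp τ x - wp τ (cls τ (τ / 2 + 1 / 4))

/-- The Legendre function `𝓛` of `E = ℂ / ⟨1, τ⟩`: the elliptic function of degree two with
simple zeros at `± 1/4`, simple poles at `τ/2 ± 1/4` and `𝓛 0 = 1`, that is,
`𝓛 = (℘ - ℘(1/4)) / (℘ - ℘(τ/2 + 1/4))`. As a map to `ℙ¹` it is
`(legendreNum : legendreDen)`; here we record its affine value
(meaningful away from the poles `τ/2 ± 1/4`). -/
def legendre (τ : ℍ) (x : E τ) : ℂ := legendreNum τ x / legendreDen τ x

/-- The branch value `a = 𝓛(τ/2)`; the four branch points of `𝓛` are `± 1, ± a`. -/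
def a (τ : ℍ) : ℂ := legendre τ (cls τ (τ / 2))

/-- The number `b = 𝓛(τ/4)`, a square root of `a`. -/
def b (τ : ℍ) : ℂ := legendre τ (cls τ (τ / 4))

/-! ### The threefold `T = E₁ × E₂ × E₃`; the indices `1, 2, 3` are `0, 1, 2 : Fin 3` -/

/-- The product of three elliptic curves. -/
abbrev Torus (τ : Fin 3 → ℍ) : Type := (j : Fin 3) → E (τ j)

/-- The universal covering `ℂ³ → T`, a local biholomorphism. -/
def proj (τ : Fin 3 → ℍ) (z : Fin 3 → ℂ) : Torus τ := fun j => cls (τ j) (z j)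

/-- `X ⊆ T` is smooth at `p`: in local coordinates of `T`, `X` is near `p` the zero set of a
holomorphic function whose differential at `p` does not vanish. -/
def IsSmoothAt {τ : Fin 3 → ℍ} (X : Set (Torus τ)) (p : Torus τ) : Prop :=
  ∃ z : Fin 3 → ℂ, proj τ z = p ∧ ∃ f : (Fin 3 → ℂ) → ℂ,
    AnalyticAt ℂ f z ∧ fderiv ℂ f z ≠ 0 ∧ ∀ᶠ w in 𝓝 z, (proj τ w ∈ X ↔ f w = 0)

/-- The singular locus of a hypersurface in `T`. -/
def Sing {τ : Fin 3 → ℍ} (X : Set (Torus τ)) : Set (Torus τ) :=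
  {p | p ∈ X ∧ ¬ IsSmoothAt X p}

/-- `p` is a node (ordinary double point) of `X ⊆ T`: in local coordinates of `T`, `X` is near `p`
the zero set of a holomorphic function with a nondegenerate critical point with value `0` at `p`. -/
def IsNode {τ : Fin 3 → ℍ} (X : Set (Torus τ)) (p : Torus τ) : Prop :=
  ∃ z : Fin 3 → ℂ, proj τ z = p ∧ ∃ f : (Fin 3 → ℂ) → ℂ,
    AnalyticAt ℂ f z ∧ f z = 0 ∧ fderiv ℂ f z = 0 ∧
    (∀ v, (∀ w, fderiv ℂ (fderiv ℂ f) z v w = 0) → v = 0) ∧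
    ∀ᶠ w in 𝓝 z, (proj τ w ∈ X ↔ f w = 0)

/-! ### The Burniat hypersurfaces -/

/-- The hypersurface `ν₁ (𝓛₁𝓛₂𝓛₃ + b₁b₂b₃) + ν₂ (b₂b₃𝓛₁ + b₁𝓛₂𝓛₃) = 0`, in homogeneous form. -/
def Xnu (τ : Fin 3 → ℍ) (ν₁ ν₂ : ℂ) : Set (Torus τ) :=
  {p | ν₁ * (legendreNum (τ 0) (p 0) * legendreNum (τ 1) (p 1) * legendreNum (τ 2) (p 2)
          + b (τ 0) * b (τ 1) * b (τ 2) *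
            (legendreDen (τ 0) (p 0) * legendreDen (τ 1) (p 1) * legendreDen (τ 2) (p 2)))
      + ν₂ * (b (τ 1) * b (τ 2) *
            (legendreNum (τ 0) (p 0) * legendreDen (τ 1) (p 1) * legendreDen (τ 2) (p 2))
          + b (τ 0) *
            (legendreDen (τ 0) (p 0) * legendreNum (τ 1) (p 1) * legendreNum (τ 2) (p 2))) = 0}

/-- The hypersurface `𝓛₁𝓛₂𝓛₃ = μ`, in homogeneous form. -/
def Xmu (τ : Fin 3 → ℍ) (μ : ℂ) : Set (Torus τ) :=
  {p | legendreNum (τ 0) (p 0) * legendreNum (τ 1) (p 1) * legendreNum (τ 2) (p 2)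
      = μ * (legendreDen (τ 0) (p 0) * legendreDen (τ 1) (p 1) * legendreDen (τ 2) (p 2))}

/-- The hypersurface `𝓛₁𝓛₂𝓛₃ = b₁b₂b₃`. -/
def Xb (τ : Fin 3 → ℍ) : Set (Torus τ) := Xmu τ (b (τ 0) * b (τ 1) * b (τ 2))

/-! ### The group `(ℤ/2)⁹` acting on `T` -/

/-- `g j = ![ζ, η, ε]` are the coordinates of `g` belonging to the `j`-th factor. -/
abbrev Grp : Type := Fin 3 → Fin 3 → ZMod 2

/-- The commuting involutions `x ↦ -x`, `x ↦ -x + τ/2`, `x ↦ -x + 1/2` of `E` correspond to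
`ζ = 1`, `η = 1`, `ε = 1` respectively. -/
def act {τ : Fin 3 → ℍ} (g : Grp) (p : Torus τ) : Torus τ := fun j =>
  ((fun x => -x)^[(g j 0).val]
    ((fun x => -x + cls (τ j) (τ j / 2))^[(g j 1).val]
      ((fun x => -x + cls (τ j) (1 / 2))^[(g j 2).val] (p j))))

/-- No nonzero element of `G` has a fixed point on `X`. -/
def ActsFreelyOn {τ : Fin 3 → ℍ} (G : AddSubgroup Grp) (X : Set (Torus τ)) : Prop :=
  ∀ g ∈ G, g ≠ 0 → ∀ p ∈ X, act g p ≠ p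

def G₁ : AddSubgroup Grp := AddSubgroup.closure
  {![![1, 0, 0], ![1, 0, 0], ![1, 0, 0]],
   ![![0, 1, 0], ![1, 1, 0], ![1, 1, 0]],
   ![![0, 0, 0], ![0, 0, 1], ![1, 0, 1]]}

def G₂ : AddSubgroup Grp := AddSubgroup.closure
  {![![1, 0, 0], ![0, 0, 1], ![1, 0, 1]],
   ![![0, 0, 1], ![0, 0, 0], ![1, 0, 1]],
   ![![0, 0, 0], ![1, 0, 1], ![0, 0, 1]]}

def G₃ : AddSubgroup Grp := AddSubgroup.closure
  {![![1, 0, 0], ![0, 0, 1], ![1, 0, 1]],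
   ![![0, 1, 0], ![0, 1, 0], ![1, 1, 0]],
   ![![0, 0, 1], ![1, 0, 1], ![1, 0, 0]]}

def G₄ : AddSubgroup Grp := AddSubgroup.closure
  {![![1, 0, 1], ![0, 0, 1], ![1, 0, 0]],
   ![![0, 1, 0], ![0, 1, 0], ![1, 1, 0]],
   ![![0, 0, 0], ![1, 0, 1], ![1, 0, 1]]}

/-- The pairs `(X, G)` consisting of a Burniat hypersurface `X` and a group `G` acting freely on it
that give rise to regular generalized Burniat type surfaces `X / G`. The conditions on `ν` and `μ`
say that the hypersurface is irreducible. -/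
inductive IsRegularPair (τ : Fin 3 → ℍ) : Set (Torus τ) → AddSubgroup Grp → Prop
  | nu (ν₁ ν₂ : ℂ) (h₀ : ![ν₁, ν₂] ≠ 0) (h₁ : ν₁ ≠ ν₂) (h₂ : ν₁ ≠ -ν₂)
      (hfree : ActsFreelyOn G₁ (Xnu τ ν₁ ν₂)) : IsRegularPair τ (Xnu τ ν₁ ν₂) G₁
  | mu (μ : ℂ) (h₀ : μ ≠ 0)
      (hfree : ActsFreelyOn G₂ (Xmu τ μ)) : IsRegularPair τ (Xmu τ μ) G₂
  | b₃ (hfree : ActsFreelyOn G₃ (Xb τ)) : IsRegularPair τ (Xb τ) G₃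
  | b₄ (hfree : ActsFreelyOn G₄ (Xb τ)) : IsRegularPair τ (Xb τ) G₄

/-! ### The special parameter values and the singular points -/

/-- The set `{(± β : 1), (1 : ± β)}` of points of `ℙ¹`. -/
def specialNu (β : ℂ) : Set (ℙ ℂ (Fin 2 → ℂ)) :=
  {Projectivization.mk ℂ ![β, 1] (by simp), Projectivization.mk ℂ ![-β, 1] (by simp),
   Projectivization.mk ℂ ![1, β] (by simp), Projectivization.mk ℂ ![1, -β] (by simp)}

/-- The set `{± 1, ± aᵢ, ± aᵢ aⱼ, ± a₁ a₂ a₃ | i ≠ j}`. -/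
def specialB (τ : Fin 3 → ℍ) : Set ℂ :=
  {x | ∃ s : ℂ, (s = 1 ∨ s = -1) ∧
    (x = s ∨ (∃ i, x = s * a (τ i)) ∨ (∃ i j, i ≠ j ∧ x = s * (a (τ i) * a (τ j))) ∨
      x = s * (a (τ 0) * a (τ 1) * a (τ 2)))}

/-- The points `(z₁, ± 1/4, ± 1/4)` with `2 z₁ = 0` and `ν b₁ + 𝓛₁(z₁) = 0`, and the points
`(z₁, τ₂/2 ± 1/4, τ₃/2 ± 1/4)` with `2 z₁ = 0` and `b₁ + ν 𝓛₁(z₁) = 0`, where `ν = ν₁ / ν₂`. -/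
def nodesNu (τ : Fin 3 → ℍ) (ν₁ ν₂ : ℂ) : Set (Torus τ) :=
  {p | (p 1 = cls (τ 1) (1 / 4) ∨ p 1 = cls (τ 1) (-(1 / 4))) ∧
       (p 2 = cls (τ 2) (1 / 4) ∨ p 2 = cls (τ 2) (-(1 / 4))) ∧
       2 • p 0 = 0 ∧ ν₁ * b (τ 0) + ν₂ * legendre (τ 0) (p 0) = 0} ∪
  {p | (p 1 = cls (τ 1) (τ 1 / 2 + 1 / 4) ∨ p 1 = cls (τ 1) (τ 1 / 2 - 1 / 4)) ∧
       (p 2 = cls (τ 2) (τ 2 / 2 + 1 / 4) ∨ p 2 = cls (τ 2) (τ 2 / 2 - 1 / 4)) ∧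
       2 • p 0 = 0 ∧ ν₂ * b (τ 0) + ν₁ * legendre (τ 0) (p 0) = 0}

end Burniat

end

noncomputable section

namespace Burniat

open PeriodPair Filter Metric

/-! ### The Weierstrass function is even of degree two -/

section Weierstrass

variable (L : PeriodPair)

/-! Near every point of `T` each of the hypersurfaces has an equation `u₀u₁u₂ + c v₀v₁v₂ = 0` with
`c ≠ 0`, where `u_j`, `v_j` are functions of the single coordinate `z_j` without common zero. For
`Xmu` they are numerator and denominator of the Legendre functions. For `Xnu` the first pair is
replaced by an invertible linear combination of itself, with determinant `b₁(ν₁² - ν₂²)`.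

On such a hypersurface the `j`-th partial derivative, multiplied by `v_j` or `u_j`, is the Wronskian
of `(u_j, v_j)` times a product of the other factors (`partial_eq_zero_iff`). So singular candidates
are the points where all three Wronskians vanish, that is, two-torsion points, or, for `Xnu` only,
the points where the first Wronskian and three suitable factors vanish. Wronskians have only simple
zeros, which makes the Hessian nondegenerate there (`hessian_nondegenerate`). A node is truly
singular, whatever equation is chosen: a Hessian isotropic on a tangent plane in dimension three is
degenerate (`IsNode.not_isSmoothAt`). All this is collected in `mem_sing_iff`. The groups `G₁` and
`G₂` contain `-1`, so freeness removes the two-torsion points.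

The analytic input is that the Wronskian of the Legendre function is a multiple of `℘'` off the
lattice. Its zeros are exactly the half periods and are simple because `℘` has degree two
(`weierstrassP_eq`), so that `℘'² = 4∏(℘ - eᵢ)` has distinct `eᵢ`. Translation by a half period is a
Möbius involution in `℘` (`weierstrassP_add_half`), which yields the values `±1, ±a` at two-torsion
points and `b² = a`. Counting eight nodes then becomes combinatorics of these values. -/

lemma countable_lattice : (L.lattice : Set ℂ).Countable :=
  Set.countable_coe_iff.mp L.latticeEquivProd.toEquiv.injective.countable

lemma eventually_notMem_lattice_diff (z : ℂ) : ∀ᶠ w in 𝓝 z, w ∉ (L.lattice : Set ℂ) \ {z} :=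
  L.compl_lattice_sdiff_singleton_mem_nhds z

lemma eventually_notMem_lattice {z : ℂ} (hz : z ∉ L.lattice) : ∀ᶠ w in 𝓝 z, w ∉ L.lattice :=
  L.isClosed_lattice.isOpen_compl.mem_nhds hz

/-- The complement of the countable lattice is connected, so by the identity theorem `℘'` would
vanish on all of it. This contradicts the triple pole at `0`, where `w³ ℘'(w) → -2`. -/
lemma derivWeierstrassP_not_eventually_zero {z : ℂ} (hz : z ∉ L.lattice) :
    ¬ ∀ᶠ w in 𝓝 z, derivWeierstrassP L w = 0 := by
  intro h
  have hconn : IsPreconnected ((L.lattice : Set ℂ)ᶜ) :=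
    ((countable_lattice L).isConnected_compl_of_one_lt_rank
      (by simp [Complex.rank_real_complex])).isPreconnected
  have h0 := L.analyticOnNhd_derivWeierstrassP.eqOn_zero_of_preconnected_of_eventuallyEq_zero
    hconn hz h
  have h1 : Tendsto (fun w : ℂ => w ^ 3 * derivWeierstrassPExcept L 0 w - 2) (𝓝[≠] 0) (𝓝 (-2)) := by
    have : ContinuousAt (fun w : ℂ => w ^ 3 * derivWeierstrassPExcept L 0 w - 2) 0 := by
      have := (L.analyticAt_derivWeierstrassPExcept 0).continuousAt
      fun_prop
    simpa using this.tendsto.mono_left nhdsWithin_le_nhds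
  have h2 : ∀ᶠ w : ℂ in 𝓝[≠] 0, w ^ 3 * derivWeierstrassPExcept L 0 w - 2 = 0 := by
    filter_upwards [mem_nhdsWithin_of_mem_nhds (eventually_notMem_lattice_diff L 0),
      self_mem_nhdsWithin] with w hw hw0
    have hw0' : w ≠ 0 := hw0
    have hwL : w ∉ L.lattice := fun h => hw ⟨h, hw0⟩
    have h3 := L.derivWeierstrassPExcept_def 0 w
    have h4 : derivWeierstrassP L w = 0 := h0 hwL
    simp only [ZeroMemClass.coe_zero, sub_zero] at h3
    rw [h3, h4]
    field_simp
    ring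
  have h5 := tendsto_nhds_unique h1 (tendsto_const_nhds.congr' (h2.mono fun _ h => h.symm))
  norm_num at h5

lemma nhds_le_map_weierstrassP {z : ℂ} (hz : z ∉ L.lattice) :
    𝓝 (weierstrassP L z) ≤ map (weierstrassP L) (𝓝 z) := by
  refine ((L.analyticOnNhd_weierstrassP z hz).eventually_constant_or_nhds_le_map_nhds).resolve_left
    fun h => derivWeierstrassP_not_eventually_zero L hz ?_
  filter_upwards [h.eventually_nhds] with w hw
  rw [← L.deriv_weierstrassP]
  have : weierstrassP L =ᶠ[𝓝 w] fun _ => weierstrassP L z := hw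
  rw [this.deriv_eq, deriv_const]

/-- Zeros of `℘'` are isolated, hence countable in number. Removing a countable set keeps the plane
connected and leaves a dense set, which is how this is used in `weierstrassP_eq`. -/
lemma countable_critical :
    ({z | z ∉ L.lattice ∧ derivWeierstrassP L z = 0} ∪ (L.lattice : Set ℂ)).Countable := by
  refine Set.Countable.union ?_ (countable_lattice L)
  have : DiscreteTopology {z | z ∉ L.lattice ∧ derivWeierstrassP L z = 0} := by
    rw [discreteTopology_subtype_iff]
    intro x hx
    have h := ((L.analyticOnNhd_derivWeierstrassP x hx.1).eventually_eq_zero_or_eventually_ne_zero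
      ).resolve_left (derivWeierstrassP_not_eventually_zero L hx.1)
    rw [← disjoint_iff, disjoint_principal_right]
    filter_upwards [h] with w hw hw'
    exact hw hw'.2
  exact Set.countable_coe_iff.mp (TopologicalSpace.separableSpace_iff_countable.mp inferInstance)

lemma exists_sub_mem_closedBall : ∃ R : ℝ, ∀ z : ℂ, ∃ l ∈ L.lattice, ‖z - l‖ ≤ R := by
  refine ⟨_, fun z => ⟨ZSpan.floor L.basis z, ?_, ZSpan.norm_fract_le L.basis z⟩⟩
  rw [L.lattice_eq_span_range_basis]
  exact (ZSpan.floor L.basis z).2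

lemma tendsto_norm_weierstrassP {l : ℂ} (hl : l ∈ L.lattice) :
    Tendsto (fun z => ‖weierstrassP L z‖) (𝓝[≠] l) atTop := by
  rw [tendsto_norm_atTop_iff_cobounded]
  refine tendsto_cobounded_of_meromorphicOrderAt_neg ?_
  rw [L.order_weierstrassP l hl]
  decide

/-- Write `℘(x) = x⁻² + f(x)` with `f` even and Lipschitz near `0`. Equal values at `x ≠ w` give `(w
- x)(x + w) = (f w - f x) x²w²`, so `‖x + w‖ ≤ K‖x‖²‖w‖²`. For `x = z` and `x = -z` together this
contradicts `2‖z‖ ≤ ‖z + w‖ + ‖-z + w‖`. -/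
lemma weierstrassP_injective_near_zero : ∃ r > 0, ∀ z w : ℂ, ‖z‖ < r → ‖w‖ < r → z ≠ 0 → w ≠ 0 →
    weierstrassP L z = weierstrassP L w → z = w ∨ z = -w := by
  obtain ⟨K, t, ht, hK⟩ :=
    ((L.analyticAt_weierstrassPExcept 0).contDiffAt (n := 1)).exists_lipschitzOnWith
  obtain ⟨r₀, hr₀, hr₀t⟩ := Metric.mem_nhds_iff.mp ht
  have hden : (0 : ℝ) < K + 1 := by positivity
  refine ⟨min r₀ (min 1 (1 / (K + 1))), by positivity, fun z w hz hw hz0 hw0 h => ?_⟩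
  simp only [lt_min_iff] at hz hw
  obtain ⟨hz1, hz2, hz3⟩ := hz
  obtain ⟨hw1, hw2, hw3⟩ := hw
  by_contra! hne
  obtain ⟨hne1, hne2⟩ := hne
  set f := weierstrassPExcept L 0 with hf
  have hexp : ∀ x, weierstrassP L x = f x + 1 / x ^ 2 := fun x => by
    have := L.weierstrassPExcept_add 0 x
    simp only [ZeroMemClass.coe_zero, sub_zero] at this
    rw [← this]; simp [hf]
  have hev : ∀ x, f (-x) = f x := fun x => by
    rw [hf, L.weierstrassPExcept_neg, neg_zero]
  have hmem : ∀ x : ℂ, ‖x‖ < r₀ → x ∈ t := fun x hx => hr₀t (by simpa using hx)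
  have key : ∀ x : ℂ, ‖x‖ < r₀ → x ≠ 0 → x ≠ w → weierstrassP L x = weierstrassP L w →
      ‖x + w‖ ≤ K * (‖x‖ ^ 2 * ‖w‖ ^ 2) := by
    intro x hx hx0 hxw hxe
    have h1 : (w - x) * (x + w) = (f w - f x) * (x ^ 2 * w ^ 2) := by
      rw [hexp, hexp] at hxe
      field_simp at hxe
      linear_combination hxe
    have h2 : ‖f w - f x‖ ≤ K * ‖w - x‖ := hK.norm_sub_le (hmem w hw1) (hmem x hx)
    have h3 := congrArg norm h1
    simp only [norm_mul, norm_pow] at h3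
    have hpos : 0 < ‖w - x‖ := norm_pos_iff.mpr (sub_ne_zero.mpr hxw.symm)
    have h4 : ‖w - x‖ * ‖x + w‖ ≤ ‖w - x‖ * (K * (‖x‖ ^ 2 * ‖w‖ ^ 2)) := by
      rw [h3]
      calc _ ≤ K * ‖w - x‖ * (‖x‖ ^ 2 * ‖w‖ ^ 2) := by gcongr
        _ = _ := by ring
    exact le_of_mul_le_mul_left h4 hpos
  have k1 := key z hz1 hz0 hne1 h
  have k2 := key (-z) (by simpa using hz1) (by simpa using hz0)
    (fun h' => hne2 (by rw [← h', neg_neg])) (by rw [L.weierstrassP_neg, h])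
  rw [norm_neg] at k2
  have k3 : 2 * ‖z‖ ≤ ‖z + w‖ + ‖-z + w‖ := by
    calc 2 * ‖z‖ = ‖(z + w) - (-z + w)‖ := by
          rw [show (z + w) - (-z + w) = 2 * z by ring, norm_mul]; simp
      _ ≤ _ := norm_sub_le _ _
  have hzpos : 0 < ‖z‖ := norm_pos_iff.mpr hz0
  have k4 : ‖z‖ ≤ ‖z‖ * (K * (‖z‖ * ‖w‖ ^ 2)) := by nlinarith
  have k5 : 1 ≤ K * (‖z‖ * ‖w‖ ^ 2) := by
    by_contra! hlt
    nlinarith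
  have k6 : ‖w‖ ^ 2 ≤ 1 := by nlinarith [norm_nonneg w]
  have k7 : ‖z‖ * ‖w‖ ^ 2 ≤ ‖z‖ := by nlinarith
  have k8 : (K : ℝ) * (‖z‖ * ‖w‖ ^ 2) ≤ K * ‖z‖ := by gcongr
  have k9 : ‖z‖ * (K + 1) < 1 := by rwa [lt_div_iff₀ hden] at hz3
  nlinarith

/-- `w` has no other preimages of its value under `℘` than `± w`. -/
def HasMinimalFibre (w : ℂ) : Prop :=
  ∀ z ∉ L.lattice, weierstrassP L z = weierstrassP L w → z - w ∈ L.lattice ∨ z + w ∈ L.lattice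

variable {L}

/-- By the open mapping property at the extra preimage `z`, nearby values are still attained near
`z`, away from the lattice translates of `± w'`. -/
lemma not_hasMinimalFibre_eventually {w : ℂ} (hw : w ∉ L.lattice) (h : ¬ HasMinimalFibre L w) :
    ∀ᶠ w' in 𝓝 w, ¬ HasMinimalFibre L w' := by
  simp only [HasMinimalFibre] at h
  push Not at h
  obtain ⟨z, hz, hzw, h1, h2⟩ := h
  have hclosed := L.isClosed_lattice.isOpen_compl
  have e1 : ∀ᶠ p : ℂ × ℂ in 𝓝 (z, w), p.1 ∉ L.lattice :=
    (continuous_fst.isOpen_preimage _ hclosed).mem_nhds hz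
  have e2 : ∀ᶠ p : ℂ × ℂ in 𝓝 (z, w), p.1 - p.2 ∉ L.lattice :=
    ((continuous_fst.sub continuous_snd).isOpen_preimage _ hclosed).mem_nhds h1
  have e3 : ∀ᶠ p : ℂ × ℂ in 𝓝 (z, w), p.1 + p.2 ∉ L.lattice :=
    ((continuous_fst.add continuous_snd).isOpen_preimage _ hclosed).mem_nhds h2
  have e := e1.and (e2.and e3)
  rw [nhds_prod_eq, eventually_prod_iff] at e
  obtain ⟨pa, hpa, pb, hpb, hab⟩ := e
  have him : weierstrassP L '' {x | pa x} ∈ 𝓝 (weierstrassP L w) := by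
    rw [← hzw]
    exact nhds_le_map_weierstrassP L hz (image_mem_map hpa)
  filter_upwards [hpb, (L.analyticOnNhd_weierstrassP w hw).continuousAt him] with w' hb hw'
  obtain ⟨z', hz', hzw'⟩ := hw'
  obtain ⟨q1, q2, q3⟩ := hab hz' hb
  exact fun hgood => (hgood z' q1 hzw').elim q2 q3

/-- A sequence of points with non-minimal fibres has, after passing to a subsequence, a convergent
sequence of additional preimages. -/
lemma exists_subseq_of_not_hasMinimalFibre (w : ℕ → ℂ) (h : ∀ n, ¬ HasMinimalFibre L (w n)) :
    ∃ (z : ℕ → ℂ) (z₀ : ℂ) (φ : ℕ → ℕ), StrictMono φ ∧ Tendsto z atTop (𝓝 z₀) ∧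
      ∀ n, z n ∉ L.lattice ∧ weierstrassP L (z n) = weierstrassP L (w (φ n)) ∧
        z n - w (φ n) ∉ L.lattice ∧ z n + w (φ n) ∉ L.lattice := by
  obtain ⟨R, hR⟩ := exists_sub_mem_closedBall L
  have : ∀ n, ∃ z, z ∈ closedBall (0 : ℂ) R ∧ z ∉ L.lattice ∧
      weierstrassP L z = weierstrassP L (w n) ∧ z - w n ∉ L.lattice ∧ z + w n ∉ L.lattice := by
    intro n
    have h := h n
    simp only [HasMinimalFibre] at h
    push Not at h
    obtain ⟨z, hz, hzw, h1, h2⟩ := h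
    obtain ⟨l, hl, hlR⟩ := hR z
    refine ⟨z - l, by simpa using hlR, fun h => hz ?_, ?_, fun h => h1 ?_, fun h => h2 ?_⟩
    · simpa using add_mem h hl
    · rw [L.weierstrassP_sub_coe z ⟨l, hl⟩, hzw]
    · have := add_mem h hl
      rwa [show z - l - w n + l = z - w n by ring] at this
    · have := add_mem h hl
      rwa [show z - l + w n + l = z + w n by ring] at this
  choose z hzR hz using this
  obtain ⟨z₀, -, φ, hφ, hlim⟩ := (isCompact_closedBall (0 : ℂ) R).tendsto_subseq hzR
  exact ⟨z ∘ φ, z₀, φ, hφ, hlim, fun n => hz (φ n)⟩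

/-- Otherwise extra preimages of values at points tending to `w` subconverge to some `z₀`. A lattice
point `z₀` is impossible, since the values stay bounded. Otherwise `z₀ ≡ ± w`, and after a
translation and a sign the extra preimages tend to `w`, where `℘` is locally injective. -/
lemma hasMinimalFibre_eventually {w : ℂ} (hw : w ∉ L.lattice) (hd : derivWeierstrassP L w ≠ 0)
    (h : HasMinimalFibre L w) : ∀ᶠ w' in 𝓝 w, HasMinimalFibre L w' := by
  by_contra hcon
  rw [not_eventually] at hcon
  obtain ⟨v, hv, hbad⟩ := exists_seq_forall_of_frequently hcon
  obtain ⟨z, z₀, φ, hφ, hlim, hz⟩ := exists_subseq_of_not_hasMinimalFibre v hbad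
  have hvφ : Tendsto (v ∘ φ) atTop (𝓝 w) := hv.comp hφ.tendsto_atTop
  have hval : Tendsto (fun n => weierstrassP L (z n)) atTop (𝓝 (weierstrassP L w)) := by
    refine (((L.analyticOnNhd_weierstrassP w hw).continuousAt.tendsto).comp hvφ).congr fun n => ?_
    exact (hz n).2.1.symm
  have hstrict : HasStrictDerivAt (weierstrassP L) (derivWeierstrassP L w) w := by
    rw [← L.deriv_weierstrassP]
    exact (L.analyticOnNhd_weierstrassP w hw).hasStrictDerivAt
  have hinv := (hstrict.hasStrictFDerivAt_equiv hd).eventually_left_inverse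
  have huniq : ∀ x : ℕ → ℂ, Tendsto x atTop (𝓝 w) →
      (∀ n, weierstrassP L (x n) = weierstrassP L (v (φ n))) → ∃ n, x n = v (φ n) := by
    intro x hx hxe
    obtain ⟨n, h1, h2⟩ := ((hx.eventually hinv).and (hvφ.eventually hinv)).exists
    refine ⟨n, ?_⟩
    rw [← h1, hxe n]
    exact h2
  by_cases hz₀ : z₀ ∈ L.lattice
  · have hne : Tendsto z atTop (𝓝[≠] z₀) := tendsto_nhdsWithin_iff.mpr
      ⟨hlim, Eventually.of_forall fun n h => (hz n).1 (by rw [h]; exact hz₀)⟩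
    exact not_tendsto_nhds_of_tendsto_atTop ((tendsto_norm_weierstrassP L hz₀).comp hne) _ hval.norm
  · have hval' := ((L.analyticOnNhd_weierstrassP z₀ hz₀).continuousAt.tendsto).comp hlim
    have heq := tendsto_nhds_unique hval' hval
    rcases h z₀ hz₀ heq with hl | hl
    · obtain ⟨n, hn⟩ := huniq (fun n => z n - (z₀ - w))
        (by simpa using hlim.sub_const (z₀ - w))
        (fun n => by rw [L.weierstrassP_sub_coe _ ⟨_, hl⟩]; exact (hz n).2.1)
      apply (hz n).2.2.1
      rw [← hn]
      simpa using hl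
    · obtain ⟨n, hn⟩ := huniq (fun n => -(z n - (z₀ + w)))
        (by simpa using (hlim.sub_const (z₀ + w)).neg)
        (fun n => by rw [L.weierstrassP_neg, L.weierstrassP_sub_coe _ ⟨_, hl⟩]; exact (hz n).2.1)
      apply (hz n).2.2.2
      rw [← hn]
      simpa using hl

/-- This supplies a starting point for the connectedness argument. Extra preimages must again
accumulate, and since `℘` blows up at `0`, only at a lattice point; there
`weierstrassP_injective_near_zero` applies. -/
lemma hasMinimalFibre_near_zero : ∀ᶠ w in 𝓝[≠] (0 : ℂ), HasMinimalFibre L w := by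
  by_contra hcon
  rw [not_eventually] at hcon
  obtain ⟨v, hv, hbad⟩ := exists_seq_forall_of_frequently hcon
  obtain ⟨z, z₀, φ, hφ, hlim, hz⟩ := exists_subseq_of_not_hasMinimalFibre v hbad
  have hvφ : Tendsto (v ∘ φ) atTop (𝓝[≠] 0) := hv.comp hφ.tendsto_atTop
  by_cases hz₀ : z₀ ∈ L.lattice
  · obtain ⟨r, hr, hinj⟩ := weierstrassP_injective_near_zero L
    have h1 : ∀ᶠ n in atTop, ‖z n - z₀‖ < r := by
      have := (hlim.sub_const z₀).norm
      simp only [sub_self, norm_zero] at this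
      exact this.eventually_lt_const hr
    rw [tendsto_nhdsWithin_iff] at hvφ
    have h2 : ∀ᶠ n in atTop, ‖v (φ n)‖ < r := by
      have := hvφ.1.norm
      simp only [norm_zero] at this
      exact this.eventually_lt_const hr
    obtain ⟨n, h1, h2, h3⟩ := (h1.and (h2.and hvφ.2)).exists
    rcases hinj (z n - z₀) (v (φ n)) h1 h2
      (fun h => (hz n).1 (by rw [sub_eq_zero.mp h]; exact hz₀)) h3
      (by rw [L.weierstrassP_sub_coe _ ⟨_, hz₀⟩]; exact (hz n).2.1) with h | h
    · apply (hz n).2.2.1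
      rw [← h]; simpa using hz₀
    · apply (hz n).2.2.2
      rw [← neg_eq_iff_eq_neg.mpr h]; simpa using hz₀
  · have hval' := ((L.analyticOnNhd_weierstrassP z₀ hz₀).continuousAt.tendsto).comp hlim
    refine not_tendsto_nhds_of_tendsto_atTop
      ((tendsto_norm_weierstrassP L (zero_mem _)).comp hvφ) _ (hval'.norm.congr fun n => ?_)
    simp [(hz n).2.1]

/-- The Weierstrass function takes every value at most at one pair of points `± w`. -/
theorem weierstrassP_eq {z w : ℂ} (hz : z ∉ L.lattice) (hw : w ∉ L.lattice)
    (h : weierstrassP L z = weierstrassP L w) : z - w ∈ L.lattice ∨ z + w ∈ L.lattice := by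
  set C := {z | z ∉ L.lattice ∧ derivWeierstrassP L z = 0} ∪ (L.lattice : Set ℂ) with hC
  have hrank : 1 < Module.rank ℝ ℂ := by simp [Complex.rank_real_complex]
  have hconn : IsPreconnected Cᶜ :=
    ((countable_critical L).isConnected_compl_of_one_lt_rank hrank).isPreconnected
  have hdense : Dense Cᶜ := (countable_critical L).dense_compl ℝ
  have hCmem : ∀ {x}, x ∈ Cᶜ ↔ x ∉ L.lattice ∧ derivWeierstrassP L x ≠ 0 := by
    intro x
    simp only [hC, Set.mem_compl_iff, Set.mem_union, Set.mem_ofPred_eq, SetLike.mem_coe]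
    tauto
  have hCev : ∀ x ∈ Cᶜ, ∀ᶠ y in 𝓝 x, y ∈ Cᶜ := by
    intro x hx
    obtain ⟨h1, h2⟩ := hCmem.mp hx
    filter_upwards [eventually_notMem_lattice L h1,
      (L.analyticOnNhd_derivWeierstrassP x h1).continuousAt.eventually_ne h2] with y q1 q2
    exact hCmem.mpr ⟨q1, q2⟩
  -- Minimality and non-minimality are both open conditions on the connected set `Cᶜ`, and
  -- minimality holds somewhere near `0`.
  have hsub : Cᶜ ⊆ {w | w ∈ Cᶜ ∧ HasMinimalFibre L w} := by
    refine hconn.subset_left_of_subset_union (v := {w | w ∈ Cᶜ ∧ ¬ HasMinimalFibre L w}) ?_ ?_ ?_ ?_ ?_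
    · rw [isOpen_iff_eventually]
      rintro x ⟨hx, hx'⟩
      obtain ⟨h1, h2⟩ := hCmem.mp hx
      exact (hCev x hx).and (hasMinimalFibre_eventually h1 h2 hx')
    · rw [isOpen_iff_eventually]
      rintro x ⟨hx, hx'⟩
      exact (hCev x hx).and (not_hasMinimalFibre_eventually (hCmem.mp hx).1 hx')
    · exact Set.disjoint_left.mpr fun x h1 h2 => h2.2 h1.2
    · intro x hx
      by_cases h : HasMinimalFibre L x
      · exact Or.inl ⟨hx, h⟩
      · exact Or.inr ⟨hx, h⟩
    · have h0 := hasMinimalFibre_near_zero (L := L)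
      rw [eventually_nhdsWithin_iff] at h0
      obtain ⟨x, hx, hxC⟩ := mem_closure_iff_frequently.mp (hdense 0) |>.and_eventually h0 |>.exists
      refine ⟨x, hx, hx, hxC ?_⟩
      rintro rfl
      exact (hCmem.mp hx).1 (zero_mem _)
  -- A critical `w` with non-minimal fibre would have non-minimal neighbours in the dense set `Cᶜ`.
  by_cases hgood : HasMinimalFibre L w
  · exact hgood z hz h
  · obtain ⟨x, hx, hxC⟩ := (mem_closure_iff_frequently.mp (hdense w)).and_eventually
      (not_hasMinimalFibre_eventually hw hgood) |>.exists
    exact absurd (hsub hx).2 hxC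

end Weierstrass

/-! ### Half periods -/

section HalfPeriods

variable {L : PeriodPair}

lemma derivWeierstrassP_half {ω : ℂ} (h2 : 2 * ω ∈ L.lattice) : derivWeierstrassP L ω = 0 := by
  have h := L.derivWeierstrassP_sub_coe ω ⟨_, h2⟩
  rw [show ω - ((⟨2 * ω, h2⟩ : L.lattice) : ℂ) = -ω by simp; ring, L.derivWeierstrassP_neg] at h
  exact CharZero.neg_eq_self_iff.mp h

lemma weierstrassP_half_cubic {ω : ℂ} (hω : ω ∉ L.lattice) (h2 : 2 * ω ∈ L.lattice) :
    4 * weierstrassP L ω ^ 3 - L.g₂ * weierstrassP L ω - L.g₃ = 0 := by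
  rw [← L.derivWeierstrassP_sq ω hω, derivWeierstrassP_half h2]; simp

lemma exists_half_periods : ∃ ω : Fin 3 → ℂ, (∀ i, ω i ∉ L.lattice ∧ 2 * ω i ∈ L.lattice) ∧
    Function.Injective (fun i => weierstrassP L (ω i)) := by
  have key : ∀ (x : ℂ) (α β : ℚ), x = α * L.ω₁ + β * L.ω₂ →
      (x ∈ L.lattice ↔ α.den = 1 ∧ β.den = 1) := by
    rintro x α β rfl; exact mul_ω₁_add_mul_ω₂_mem_lattice
  have n1 : L.ω₁ / 2 ∉ L.lattice := L.ω₁_div_two_notMem_lattice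
  have n2 : L.ω₂ / 2 ∉ L.lattice := L.ω₂_div_two_notMem_lattice
  have n3 : (L.ω₁ + L.ω₂) / 2 ∉ L.lattice := by
    rw [key _ (1 / 2) (1 / 2) (by push_cast; ring)]; norm_num
  refine ⟨![L.ω₁ / 2, L.ω₂ / 2, (L.ω₁ + L.ω₂) / 2], ?_, ?_⟩
  · intro i
    fin_cases i
    · refine ⟨n1, ?_⟩
      simpa [mul_div_cancel₀] using L.ω₁_mem_lattice
    · refine ⟨n2, ?_⟩
      simpa [mul_div_cancel₀] using L.ω₂_mem_lattice
    · refine ⟨n3, ?_⟩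
      simpa [mul_div_cancel₀] using add_mem L.ω₁_mem_lattice L.ω₂_mem_lattice
  · have h12 : weierstrassP L (L.ω₁ / 2) ≠ weierstrassP L (L.ω₂ / 2) := by
      intro h
      rcases weierstrassP_eq n1 n2 h with h | h
      · rw [key _ (1 / 2) (-1 / 2) (by push_cast; ring)] at h; norm_num at h
      · rw [key _ (1 / 2) (1 / 2) (by push_cast; ring)] at h; norm_num at h
    have h13 : weierstrassP L (L.ω₁ / 2) ≠ weierstrassP L ((L.ω₁ + L.ω₂) / 2) := by
      intro h
      rcases weierstrassP_eq n1 n3 h with h | h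
      · rw [key _ 0 (-1 / 2) (by push_cast; ring)] at h; norm_num at h
      · rw [key _ 1 (1 / 2) (by push_cast; ring)] at h; norm_num at h
    have h23 : weierstrassP L (L.ω₂ / 2) ≠ weierstrassP L ((L.ω₁ + L.ω₂) / 2) := by
      intro h
      rcases weierstrassP_eq n2 n3 h with h | h
      · rw [key _ (-1 / 2) 0 (by push_cast; ring)] at h; norm_num at h
      · rw [key _ (1 / 2) 1 (by push_cast; ring)] at h; norm_num at h
    intro i j hij
    fin_cases i <;> fin_cases j <;> first | rfl | skip
    · exact absurd hij h12
    · exact absurd hij h13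
    · exact absurd hij h12.symm
    · exact absurd hij h23
    · exact absurd hij h13.symm
    · exact absurd hij h23.symm

/-- Vieta's relations, obtained by taking divided differences twice. -/
lemma cubic_factor {K : Type*} [Field K] {c p q : K} {e₁ e₂ e₃ : K} (h12 : e₁ ≠ e₂) (h13 : e₁ ≠ e₃)
    (h23 : e₂ ≠ e₃) (h1 : c * e₁ ^ 3 - p * e₁ - q = 0) (h2 : c * e₂ ^ 3 - p * e₂ - q = 0)
    (h3 : c * e₃ ^ 3 - p * e₃ - q = 0) :
    c * (e₁ + e₂ + e₃) = 0 ∧ p = -c * (e₁ * e₂ + e₁ * e₃ + e₂ * e₃) ∧ q = c * (e₁ * e₂ * e₃) := by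
  have a12 : c * (e₁ ^ 2 + e₁ * e₂ + e₂ ^ 2) - p = 0 := by
    apply mul_left_cancel₀ (sub_ne_zero.mpr h12); linear_combination h1 - h2
  have a13 : c * (e₁ ^ 2 + e₁ * e₃ + e₃ ^ 2) - p = 0 := by
    apply mul_left_cancel₀ (sub_ne_zero.mpr h13); linear_combination h1 - h3
  have s : c * (e₁ + e₂ + e₃) = 0 := by
    apply mul_left_cancel₀ (sub_ne_zero.mpr h23); linear_combination a12 - a13
  refine ⟨s, ?_, ?_⟩
  · linear_combination -a12 + (e₁ + e₂) * s
  · linear_combination -h1 + e₁ * a12 - e₁ * e₂ * s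

lemma weierstrassP_cubic_factor {ω : Fin 3 → ℂ} (hω : ∀ i, ω i ∉ L.lattice ∧ 2 * ω i ∈ L.lattice)
    (hinj : Function.Injective (fun i => weierstrassP L (ω i))) (x : ℂ) :
    4 * x ^ 3 - L.g₂ * x - L.g₃ = 4 * (x - weierstrassP L (ω 0)) * (x - weierstrassP L (ω 1)) *
      (x - weierstrassP L (ω 2)) := by
  obtain ⟨s, h1, h2⟩ := cubic_factor (fun h => absurd (hinj h) (by decide : (0 : Fin 3) ≠ 1))
    (fun h => absurd (hinj h) (by decide : (0 : Fin 3) ≠ 2))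
    (fun h => absurd (hinj h) (by decide : (1 : Fin 3) ≠ 2))
    (weierstrassP_half_cubic (hω 0).1 (hω 0).2) (weierstrassP_half_cubic (hω 1).1 (hω 1).2)
    (weierstrassP_half_cubic (hω 2).1 (hω 2).2)
  linear_combination (-x) * h1 - h2 + x ^ 2 * s

/-- From `℘'² = 4∏(℘ - eᵢ)`, a zero of `℘'` has `℘ z = ℘ ωᵢ` for a half period `ωᵢ`, hence `z ≡ ±
ωᵢ` by `weierstrassP_eq`. -/
lemma derivWeierstrassP_eq_zero_iff {z : ℂ} (hz : z ∉ L.lattice) :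
    derivWeierstrassP L z = 0 ↔ 2 * z ∈ L.lattice := by
  refine ⟨fun h => ?_, derivWeierstrassP_half⟩
  obtain ⟨ω, hω, hinj⟩ := exists_half_periods (L := L)
  have h1 := L.derivWeierstrassP_sq z hz
  rw [h, weierstrassP_cubic_factor hω hinj] at h1
  have h2 : ∃ i, weierstrassP L z = weierstrassP L (ω i) := by
    have h4 : (4 : ℂ) ≠ 0 := by norm_num
    replace h1 := h1.symm
    simp only [ne_eq, OfNat.ofNat_ne_zero, not_false_eq_true, zero_pow, mul_eq_zero, h4,
      false_or, sub_eq_zero] at h1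
    rcases h1 with (h1 | h1) | h1
    exacts [⟨_, h1⟩, ⟨_, h1⟩, ⟨_, h1⟩]
  obtain ⟨i, hi⟩ := h2
  rcases weierstrassP_eq hz (hω i).1 hi with h3 | h3
  · have := add_mem (add_mem h3 h3) (hω i).2
    rwa [show z - ω i + (z - ω i) + 2 * ω i = 2 * z by ring] at this
  · have := sub_mem (add_mem h3 h3) (hω i).2
    rwa [show z + ω i + (z + ω i) - 2 * ω i = 2 * z by ring] at this

/-- Differentiate the cubic equation for `℘'²` and cancel `℘'`. At the isolated zeros of `℘'` the
identity follows by continuity. -/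
lemma deriv_derivWeierstrassP {z : ℂ} (hz : z ∉ L.lattice) :
    2 * deriv (derivWeierstrassP L) z = 12 * weierstrassP L z ^ 2 - L.g₂ := by
  have hdiff : ∀ {w}, w ∉ L.lattice → HasDerivAt (weierstrassP L) (derivWeierstrassP L w) w :=
    fun hw => by
      rw [← L.deriv_weierstrassP]
      exact (L.analyticOnNhd_weierstrassP _ hw).differentiableAt.hasDerivAt
  have hdiff' : ∀ {w}, w ∉ L.lattice →
      HasDerivAt (derivWeierstrassP L) (deriv (derivWeierstrassP L) w) w :=
    fun hw => (L.analyticOnNhd_derivWeierstrassP _ hw).differentiableAt.hasDerivAt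
  have h1 : ∀ᶠ w in 𝓝[≠] z, 2 * deriv (derivWeierstrassP L) w = 12 * weierstrassP L w ^ 2 - L.g₂ := by
    have hne := ((L.analyticOnNhd_derivWeierstrassP z hz).eventually_eq_zero_or_eventually_ne_zero
      ).resolve_left (derivWeierstrassP_not_eventually_zero L hz)
    filter_upwards [hne, mem_nhdsWithin_of_mem_nhds (eventually_notMem_lattice L hz)] with w hw hwL
    have e1 := (hdiff' hwL).pow 2
    have e2 := ((((hdiff hwL).pow 3).const_mul 4).sub ((hdiff hwL).const_mul L.g₂)).sub_const L.g₃
    have e3 : (derivWeierstrassP L ^ 2) =ᶠ[𝓝 w]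
        ((fun y => 4 * (weierstrassP L ^ 3) y) - fun y => L.g₂ * weierstrassP L y) - fun _ => L.g₃ := by
      filter_upwards [eventually_notMem_lattice L hwL] with y hy
      simpa using L.derivWeierstrassP_sq y hy
    have e4 := e1.unique (e2.congr_of_eventuallyEq e3)
    apply mul_left_cancel₀ hw
    norm_num at e4
    linear_combination e4
  have c1 : Tendsto (fun w => 2 * deriv (derivWeierstrassP L) w) (𝓝[≠] z)
      (𝓝 (2 * deriv (derivWeierstrassP L) z)) := by
    have := (L.analyticOnNhd_derivWeierstrassP z hz).deriv.continuousAt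
    exact (this.const_mul 2).tendsto.mono_left nhdsWithin_le_nhds
  have c2 : Tendsto (fun w => 12 * weierstrassP L w ^ 2 - L.g₂) (𝓝[≠] z)
      (𝓝 (12 * weierstrassP L z ^ 2 - L.g₂)) := by
    have := (L.analyticOnNhd_weierstrassP z hz).continuousAt
    exact (((this.tendsto.pow 2).const_mul 12).sub_const _).mono_left nhdsWithin_le_nhds
  exact tendsto_nhds_unique (c1.congr' h1) c2

/-- Here `2℘''` is the derivative of the cubic at the root `℘ z`, and the three roots are distinct.
-/
lemma deriv_derivWeierstrassP_ne_zero {z : ℂ} (hz : z ∉ L.lattice) (h2 : 2 * z ∈ L.lattice) :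
    deriv (derivWeierstrassP L) z ≠ 0 := by
  intro h
  have h1 := deriv_derivWeierstrassP hz
  obtain ⟨ω, hω, hinj⟩ := exists_half_periods (L := L)
  have h3 := weierstrassP_half_cubic hz h2
  have n01 : weierstrassP L (ω 0) - weierstrassP L (ω 1) ≠ 0 :=
    sub_ne_zero.mpr fun h => absurd (hinj h) (by decide : (0 : Fin 3) ≠ 1)
  have n02 : weierstrassP L (ω 0) - weierstrassP L (ω 2) ≠ 0 :=
    sub_ne_zero.mpr fun h => absurd (hinj h) (by decide : (0 : Fin 3) ≠ 2)
  have n12 : weierstrassP L (ω 1) - weierstrassP L (ω 2) ≠ 0 :=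
    sub_ne_zero.mpr fun h => absurd (hinj h) (by decide : (1 : Fin 3) ≠ 2)
  rw [h, mul_zero] at h1
  obtain ⟨s, k1, k2⟩ := cubic_factor (sub_ne_zero.mp n01) (sub_ne_zero.mp n02) (sub_ne_zero.mp n12)
    (weierstrassP_half_cubic (hω 0).1 (hω 0).2) (weierstrassP_half_cubic (hω 1).1 (hω 1).2)
    (weierstrassP_half_cubic (hω 2).1 (hω 2).2)
  rw [weierstrassP_cubic_factor hω hinj] at h3
  have h4 : (4 : ℂ) ≠ 0 := by norm_num
  generalize weierstrassP L (ω 0) = e₁ at *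
  generalize weierstrassP L (ω 1) = e₂ at *
  generalize weierstrassP L (ω 2) = e₃ at *
  simp only [mul_eq_zero, h4, false_or, sub_eq_zero] at h3
  rcases h3 with (h3 | h3) | h3
  · apply mul_ne_zero n01 n02
    rw [h3] at h1
    linear_combination (-1 / 4) * h1 + (1 / 4) * k1 + (-e₁ / 2) * s
  · apply mul_ne_zero n01 n12
    rw [h3] at h1
    linear_combination (1 / 4) * h1 + (-1 / 4) * k1 + (e₂ / 2) * s
  · apply mul_ne_zero n02 n12
    rw [h3] at h1
    linear_combination (-1 / 4) * h1 + (1 / 4) * k1 + (-e₃ / 2) * s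

/-- A doubly periodic meromorphic function without poles is constant. -/
lemma Meromorphic.const_of_periodic {f : ℂ → ℂ} (hf : Meromorphic f)
    (hper : ∀ z, ∀ l ∈ L.lattice, f (z + l) = f z) (hord : ∀ z, 0 ≤ meromorphicOrderAt f z) :
    ∃ c, ∀ z, ContinuousAt f z → f z = c := by
  have hfU : MeromorphicOn f Set.univ := fun z _ => hf z
  -- The function `f` may take arbitrary values at removable singularities. Its normal form `g` is
  -- entire and periodic, hence bounded; Liouville applies to `g` and transfers to `f` wherever `f`
  -- is continuous.
  set g := toMeromorphicNFOn f Set.univ with hg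
  have hNF := meromorphicNFOn_toMeromorphicNFOn f Set.univ
  have hfg : ∀ z, f =ᶠ[𝓝[≠] z] g := fun z =>
    (hfU.toMeromorphicNFOn_eq_self_on_nhdsNE (Set.mem_univ z)).symm
  have hgan : ∀ z, AnalyticAt ℂ g z := fun z => by
    rw [← (hNF (Set.mem_univ z)).meromorphicOrderAt_nonneg_iff_analyticAt,
      meromorphicOrderAt_toMeromorphicNFOn hfU (Set.mem_univ z)]
    exact hord z
  have hgd : Differentiable ℂ g := fun z => (hgan z).differentiableAt
  have hlim : ∀ z, Tendsto f (𝓝[≠] z) (𝓝 (g z)) := fun z =>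
    ((hgan z).continuousAt.tendsto.mono_left nhdsWithin_le_nhds).congr' (hfg z).symm
  have hgper : ∀ z w, w ∈ L.lattice → g (z + w) = g z := by
    intro z w hw
    have h1 : Tendsto (fun x => x + w) (𝓝[≠] z) (𝓝[≠] (z + w)) := by
      refine tendsto_nhdsWithin_iff.mpr ⟨?_, ?_⟩
      · exact ((continuous_id.add continuous_const).tendsto z).mono_left nhdsWithin_le_nhds
      · filter_upwards [self_mem_nhdsWithin] with x hx
        simpa using hx
    exact tendsto_nhds_unique ((hlim (z + w)).comp h1)
      ((hlim z).congr fun x => (hper x w hw).symm)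
  refine ⟨g 0, fun z hz => ?_⟩
  rw [tendsto_nhds_unique (hz.tendsto.mono_left nhdsWithin_le_nhds) (hlim z)]
  exact hgd.apply_eq_apply_of_bounded
    (IsZLattice.isCompact_range_of_periodic L.lattice g hgd.continuous hgper).isBounded z 0

lemma weierstrassP_sub_order_half {ω z : ℂ} (hω : ω ∉ L.lattice) (h2 : 2 * ω ∈ L.lattice)
    (hz : z - ω ∈ L.lattice) :
    2 ≤ meromorphicOrderAt (fun x => weierstrassP L x - weierstrassP L ω) z := by
  have hzL : z ∉ L.lattice := fun h => hω (by simpa using sub_mem h hz)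
  have hval : weierstrassP L z = weierstrassP L ω := by
    have := L.weierstrassP_add_coe ω ⟨_, hz⟩
    simpa using this
  have h2z : 2 * z ∈ L.lattice := by
    have := add_mem (add_mem hz hz) h2
    rwa [show z - ω + (z - ω) + 2 * ω = 2 * z by ring] at this
  have han : AnalyticAt ℂ (fun x => weierstrassP L x - weierstrassP L ω) z :=
    (L.analyticOnNhd_weierstrassP z hzL).sub analyticAt_const
  rw [han.meromorphicOrderAt_eq]
  have : (2 : ℕ∞) ≤ analyticOrderAt (fun x => weierstrassP L x - weierstrassP L ω) z := by
    refine (natCast_le_analyticOrderAt_iff_iteratedDeriv_eq_zero han (n := 2)).mpr fun i hi => ?_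
    interval_cases i
    · simp [hval]
    · simp [iteratedDeriv_one, L.deriv_weierstrassP, derivWeierstrassP_half h2z]
  exact ENat.monotone_map_iff.mpr Nat.mono_cast this

lemma weierstrassP_sub_order_nonneg {z : ℂ} (hz : z ∉ L.lattice) (c : ℂ) :
    0 ≤ meromorphicOrderAt (fun x => weierstrassP L x - c) z :=
  ((L.analyticOnNhd_weierstrassP z hz).sub analyticAt_const).meromorphicOrderAt_nonneg

lemma weierstrassP_sub_order_lattice {z : ℂ} (hz : z ∈ L.lattice) (c : ℂ) :
    meromorphicOrderAt (fun x => weierstrassP L x - c) z = -2 := by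
  have h := meromorphicOrderAt_add_eq_left_of_lt (f₁ := weierstrassP L) (f₂ := fun _ => -c) (x := z)
    (MeromorphicAt.const _ _) (by
      rw [L.order_weierstrassP z hz]
      exact lt_of_lt_of_le (by decide) (analyticAt_const.meromorphicOrderAt_nonneg))
  rw [L.order_weierstrassP z hz] at h
  rw [← h]
  congr 1

/-- Translation by a half period `ω` acts on `℘` by an involution exchanging `∞` and `℘ ω`. -/
theorem weierstrassP_add_half {ω : ℂ} (hω : ω ∉ L.lattice) (h2 : 2 * ω ∈ L.lattice) :
    ∃ K, ∀ z, z ∉ L.lattice → z + ω ∉ L.lattice →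
      (weierstrassP L z - weierstrassP L ω) * (weierstrassP L (z + ω) - weierstrassP L ω) = K := by
  set f : ℂ → ℂ := fun z => weierstrassP L z - weierstrassP L ω with hf
  have hfm : Meromorphic f := L.meromorphic_weierstrassP.sub (Meromorphic.const _)
  have hsh : ∀ z, MeromorphicAt (fun z => f (z + ω)) z := fun z =>
    (hfm (z + ω)).comp_analyticAt (g := fun z => z + ω) (by fun_prop)
  have hm : Meromorphic (f * fun z => f (z + ω)) := fun z => (hfm z).mul (hsh z)
  have hper : ∀ z, ∀ l ∈ L.lattice, f (z + l) = f z := fun z l hl => by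
    simp only [hf, L.weierstrassP_add_coe z ⟨l, hl⟩]
  obtain ⟨c, hc⟩ := Meromorphic.const_of_periodic (L := L) hm
    (fun z l hl => by
      simp only [Pi.mul_apply, hper z l hl]
      rw [add_right_comm, hper _ l hl]) (fun z => by
      -- The double poles of each factor sit at double zeros of the other.
      rw [meromorphicOrderAt_mul (hfm z) (hsh z), show (fun z => f (z + ω)) = f ∘ (· + ω) from rfl,
        meromorphicOrderAt_comp_add_const_eq_meromorphicOrderAt]
      by_cases h1 : z ∈ L.lattice
      · rw [weierstrassP_sub_order_lattice h1]
        have := weierstrassP_sub_order_half hω h2 (z := z + ω) (by simpa using h1)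
        calc (0 : WithTop ℤ) = -2 + 2 := by decide
          _ ≤ _ := by gcongr
      · by_cases h3 : z + ω ∈ L.lattice
        · rw [weierstrassP_sub_order_lattice h3]
          have := weierstrassP_sub_order_half hω h2 (z := z) (by
            have := sub_mem h3 h2
            rwa [show z + ω - 2 * ω = z - ω by ring] at this)
          calc (0 : WithTop ℤ) = 2 + -2 := by decide
            _ ≤ _ := by gcongr
        · exact add_nonneg (weierstrassP_sub_order_nonneg h1 _) (weierstrassP_sub_order_nonneg h3 _))
  refine ⟨c, fun z h1 h3 => hc z ?_⟩
  have c1 : ContinuousAt f z := ((L.analyticOnNhd_weierstrassP z h1).sub analyticAt_const).continuousAt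
  have c2 : ContinuousAt f (z + ω) :=
    ((L.analyticOnNhd_weierstrassP _ h3).sub analyticAt_const).continuousAt
  exact c1.mul (c2.comp_of_eq (f := fun z => z + ω) (by fun_prop) rfl)

end HalfPeriods

/-! ### The Legendre function -/

section Legendre

variable {τ : ℍ}

lemma mem_lattice_iff {x : ℂ} (α β : ℚ) (h : x = α + β * τ) :
    x ∈ (periods τ).lattice ↔ α.den = 1 ∧ β.den = 1 := by
  subst h
  have := (periods τ).mul_ω₁_add_mul_ω₂_mem_lattice (α := α) (β := β)
  simpa [periods] using this

lemma cls_eq_iff {x y : ℂ} : cls τ x = cls τ y ↔ x - y ∈ (periods τ).lattice :=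
  Submodule.Quotient.eq _

lemma cls_eq_zero_iff {x : ℂ} : cls τ x = 0 ↔ x ∈ (periods τ).lattice :=
  Submodule.Quotient.mk_eq_zero _

lemma cls_surjective : Function.Surjective (cls τ) := Submodule.Quotient.mk_surjective _

lemma cls_add (x y : ℂ) : cls τ (x + y) = cls τ x + cls τ y := rfl

lemma cls_neg (x : ℂ) : cls τ (-x) = -cls τ x := rfl

lemma wp_cls (z : ℂ) : wp τ (cls τ z) = weierstrassP (periods τ) z := rfl

lemma two_smul_cls (z : ℂ) : 2 • cls τ z = cls τ (2 * z) := by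
  rw [two_nsmul, two_mul, cls_add]

lemma wp_eq_iff {x y : E τ} (hx : x ≠ 0) (hy : y ≠ 0) : wp τ x = wp τ y ↔ x = y ∨ x = -y := by
  obtain ⟨z, rfl⟩ := cls_surjective x
  obtain ⟨w, rfl⟩ := cls_surjective y
  rw [← cls_neg, cls_eq_iff, cls_eq_iff, sub_neg_eq_add]
  rw [ne_eq, cls_eq_zero_iff] at hx hy
  refine ⟨weierstrassP_eq hx hy, ?_⟩
  rintro (h | h)
  · have := (periods τ).weierstrassP_add_coe w ⟨_, h⟩
    simpa [wp_cls] using this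
  · have := (periods τ).weierstrassP_add_coe (-w) ⟨_, h⟩
    simpa [wp_cls] using this

lemma wp_add_half {h : E τ} (h0 : h ≠ 0) (h2 : 2 • h = 0) :
    ∃ K, ∀ x, x ≠ 0 → x ≠ h → (wp τ x - wp τ h) * (wp τ (x + h) - wp τ h) = K := by
  obtain ⟨ω, rfl⟩ := cls_surjective h
  rw [two_smul_cls, cls_eq_zero_iff] at h2
  rw [ne_eq, cls_eq_zero_iff] at h0
  obtain ⟨K, hK⟩ := weierstrassP_add_half h0 h2
  refine ⟨K, fun x hx hxh => ?_⟩
  obtain ⟨z, rfl⟩ := cls_surjective x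
  rw [ne_eq, cls_eq_zero_iff] at hx
  rw [ne_eq, cls_eq_iff] at hxh
  refine hK z hx fun h => hxh ?_
  have := sub_mem h h2
  rwa [show z + ω - 2 * ω = z - ω by ring] at this

/-- Two multiples of `1/4` and `τ/4` are congruent modulo the lattice iff the coefficients are
congruent modulo `4`. -/
lemma cls_quarter_eq_iff {x y : ℂ} (m n m' n' : ℤ) (hx : x = m / 4 + n / 4 * τ)
    (hy : y = m' / 4 + n' / 4 * τ) : cls τ x = cls τ y ↔ (4 ∣ m - m') ∧ (4 ∣ n - n') := by
  rw [cls_eq_iff, mem_lattice_iff (((m - m' : ℤ) : ℚ) / (4 : ℤ)) (((n - n' : ℤ) : ℚ) / (4 : ℤ))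
    (by rw [hx, hy]; push_cast; ring), Rat.den_div_intCast_eq_one_iff _ _ (by norm_num),
    Rat.den_div_intCast_eq_one_iff _ _ (by norm_num)]

lemma cls_quarter_eq_zero_iff {x : ℂ} (m n : ℤ) (hx : x = m / 4 + n / 4 * τ) :
    cls τ x = 0 ↔ (4 ∣ m) ∧ (4 ∣ n) := by
  rw [show (0 : E τ) = cls τ 0 from rfl, cls_quarter_eq_iff m n 0 0 hx (by simp)]
  simp

/-! ### Zeros and poles of the Legendre function -/

lemma zero_ne_quarter : cls τ (1 / 4) ≠ 0 := by
  rw [ne_eq, cls_quarter_eq_zero_iff 1 0 (by push_cast; ring)]; decide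

lemma pole_ne_zero : cls τ (τ / 2 + 1 / 4) ≠ 0 := by
  rw [ne_eq, cls_quarter_eq_zero_iff 1 2 (by push_cast; ring)]; decide

lemma wp_zero_ne_wp_pole : wp τ (cls τ (1 / 4)) ≠ wp τ (cls τ (τ / 2 + 1 / 4)) := by
  rw [ne_eq, wp_eq_iff zero_ne_quarter pole_ne_zero, ← cls_neg,
    cls_quarter_eq_iff 1 0 1 2 (by push_cast; ring) (by push_cast; ring),
    cls_quarter_eq_iff 1 0 (-1) (-2) (by push_cast; ring) (by push_cast; ring)]
  decide

lemma legendreNum_eq_zero_iff {x : E τ} :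
    legendreNum τ x = 0 ↔ x = cls τ (1 / 4) ∨ x = cls τ (-(1 / 4)) := by
  unfold legendreNum
  split_ifs with h
  · simp only [one_ne_zero, false_iff, not_or, h, cls_neg]
    exact ⟨zero_ne_quarter.symm, (neg_ne_zero.mpr zero_ne_quarter).symm⟩
  · rw [sub_eq_zero, wp_eq_iff h zero_ne_quarter, cls_neg]

lemma legendreDen_eq_zero_iff {x : E τ} :
    legendreDen τ x = 0 ↔ x = cls τ (τ / 2 + 1 / 4) ∨ x = cls τ (τ / 2 - 1 / 4) := by
  have hneg : cls τ (τ / 2 - 1 / 4) = - cls τ (τ / 2 + 1 / 4) := by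
    rw [← cls_neg, cls_quarter_eq_iff (-1) 2 (-1) (-2) (by push_cast; ring) (by push_cast; ring)]
    decide
  unfold legendreDen
  split_ifs with h
  · simp only [one_ne_zero, false_iff, not_or, h, hneg]
    exact ⟨pole_ne_zero.symm, (neg_ne_zero.mpr pole_ne_zero).symm⟩
  · rw [sub_eq_zero, wp_eq_iff h pole_ne_zero, hneg]

lemma legendreDen_ne_zero_of_num {x : E τ} (h : legendreNum τ x = 0) : legendreDen τ x ≠ 0 := by
  unfold legendreNum at h
  unfold legendreDen
  split_ifs at h ⊢ with hx
  · simp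
  · rw [sub_eq_zero.mp h]; exact sub_ne_zero.mpr wp_zero_ne_wp_pole

lemma two_smul_eq_zero_iff {x : E τ} : 2 • x = 0 ↔ x = 0 ∨ x = cls τ (1 / 2) ∨ x = cls τ (τ / 2) ∨
    x = cls τ (1 / 2) + cls τ (τ / 2) := by
  constructor
  · obtain ⟨z, rfl⟩ := cls_surjective x
    rw [two_smul_cls, cls_eq_zero_iff, mem_lattice]
    rintro ⟨m, n, h⟩
    have hz : z = ((2 * m : ℤ) : ℂ) / 4 + ((2 * n : ℤ) : ℂ) / 4 * τ := by
      simp only [periods] at h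
      push_cast; linear_combination (-1 / 2) * h
    rw [← cls_add, cls_quarter_eq_zero_iff _ _ hz,
      cls_quarter_eq_iff _ _ 2 0 hz (by push_cast; ring),
      cls_quarter_eq_iff _ _ 0 2 hz (by push_cast; ring),
      cls_quarter_eq_iff _ _ 2 2 hz (by push_cast; ring)]
    omega
  · have h1 : 2 • cls τ (1 / 2) = 0 := by
      rw [two_smul_cls, cls_quarter_eq_zero_iff 4 0 (by push_cast; ring)]; decide
    have h2 : 2 • cls τ (τ / 2) = 0 := by
      rw [two_smul_cls, cls_quarter_eq_zero_iff 0 4 (by push_cast; ring)]; decide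
    rintro (rfl | rfl | rfl | rfl)
    · simp
    · exact h1
    · exact h2
    · rw [smul_add, h1, h2, add_zero]

lemma half_ne_zero : cls τ (1 / 2) ≠ 0 := by
  rw [ne_eq, cls_quarter_eq_zero_iff 2 0 (by push_cast; ring)]; decide

lemma half_tau_ne_zero : cls τ (τ / 2) ≠ 0 := by
  rw [ne_eq, cls_quarter_eq_zero_iff 0 2 (by push_cast; ring)]; decide

lemma half_ne_half_tau : cls τ (1 / 2) ≠ cls τ (τ / 2) := by
  rw [ne_eq, cls_quarter_eq_iff 2 0 0 2 (by push_cast; ring) (by push_cast; ring)]; decide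

lemma half_add_half_tau_ne_zero : cls τ (1 / 2) + cls τ (τ / 2) ≠ 0 := by
  rw [← cls_add, ne_eq, cls_quarter_eq_zero_iff 2 2 (by push_cast; ring)]; decide

lemma neg_eq_self_of_two_smul {x : E τ} (h : 2 • x = 0) : -x = x := by
  rw [two_nsmul] at h
  exact neg_eq_of_add_eq_zero_left h

lemma legendreNum_ne_zero_of_two_smul {x : E τ} (h : 2 • x = 0) : legendreNum τ x ≠ 0 := by
  rw [ne_eq, legendreNum_eq_zero_iff]
  rintro (rfl | rfl) <;> rw [two_smul_cls] at h
  · rw [cls_quarter_eq_zero_iff 2 0 (by push_cast; ring)] at h; revert h; decide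
  · rw [cls_quarter_eq_zero_iff (-2) 0 (by push_cast; ring)] at h; revert h; decide

lemma legendreDen_ne_zero_of_two_smul {x : E τ} (h : 2 • x = 0) : legendreDen τ x ≠ 0 := by
  rw [ne_eq, legendreDen_eq_zero_iff]
  rintro (rfl | rfl) <;> rw [two_smul_cls] at h
  · rw [cls_quarter_eq_zero_iff 2 4 (by push_cast; ring)] at h; revert h; decide
  · rw [cls_quarter_eq_zero_iff (-2) 4 (by push_cast; ring)] at h; revert h; decide

/-! ### Values of the Legendre function at two-torsion points -/

lemma legendre_zero : legendre τ 0 = 1 := by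
  simp [legendre, legendreNum, legendreDen]

lemma legendre_of_ne_zero {x : E τ} (h : x ≠ 0) : legendre τ x =
    (wp τ x - wp τ (cls τ (1 / 4))) / (wp τ x - wp τ (cls τ (τ / 2 + 1 / 4))) := by
  simp [legendre, legendreNum, legendreDen, h]

lemma wp_sub_pole_ne_zero {x : E τ} (h0 : x ≠ 0) (h : legendreDen τ x ≠ 0) :
    wp τ x - wp τ (cls τ (τ / 2 + 1 / 4)) ≠ 0 := by
  simpa [legendreDen, h0] using h

lemma wp_sub_zero_ne_zero {x : E τ} (h0 : x ≠ 0) (h : legendreNum τ x ≠ 0) :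
    wp τ x - wp τ (cls τ (1 / 4)) ≠ 0 := by
  simpa [legendreNum, h0] using h

lemma two_smul_half : 2 • cls τ (1 / 2) = 0 := two_smul_eq_zero_iff.mpr (by simp)

lemma two_smul_half_tau : 2 • cls τ (τ / 2) = 0 := two_smul_eq_zero_iff.mpr (by simp)

lemma two_smul_half_add_half_tau : 2 • (cls τ (1 / 2) + cls τ (τ / 2)) = 0 :=
  two_smul_eq_zero_iff.mpr (by simp)

/-- `℘(1/2)` is the mean of `℘(1/4)` and `℘(τ/2 + 1/4)`, and the translation by `1/2` acts on `℘`
accordingly. -/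
lemma wp_half_relations :
    wp τ (cls τ (1 / 4)) + wp τ (cls τ (τ / 2 + 1 / 4)) = 2 * wp τ (cls τ (1 / 2)) ∧
    (wp τ (cls τ (τ / 2)) - wp τ (cls τ (1 / 2))) *
      (wp τ (cls τ (1 / 2) + cls τ (τ / 2)) - wp τ (cls τ (1 / 2))) =
      (wp τ (cls τ (1 / 4)) - wp τ (cls τ (1 / 2))) ^ 2 := by
  -- Translation by `1/2` sends both `1/4` and `τ/2 + 1/4` to their negatives, so `K` is the square
  -- of `℘ - ℘(1/2)` at either point. As the two values of `℘` differ, the differences are opposite.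
  obtain ⟨K, hK⟩ := wp_add_half (τ := τ) half_ne_zero two_smul_half
  have q1 := hK (cls τ (1 / 4)) zero_ne_quarter (by
    rw [ne_eq, cls_quarter_eq_iff 1 0 2 0 (by push_cast; ring) (by push_cast; ring)]; decide)
  have q2 := hK (cls τ (τ / 2 + 1 / 4)) pole_ne_zero (by
    rw [ne_eq, cls_quarter_eq_iff 1 2 2 0 (by push_cast; ring) (by push_cast; ring)]; decide)
  have q3 := hK (cls τ (τ / 2)) half_tau_ne_zero half_ne_half_tau.symm
  have e1 : wp τ (cls τ (1 / 4) + cls τ (1 / 2)) = wp τ (cls τ (1 / 4)) := by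
    have : cls τ (1 / 4) + cls τ (1 / 2) = - cls τ (1 / 4) := by
      rw [← cls_add, ← cls_neg,
        cls_quarter_eq_iff 3 0 (-1) 0 (by push_cast; ring) (by push_cast; ring)]; decide
    rw [this, wp_eq_iff (neg_ne_zero.mpr zero_ne_quarter) zero_ne_quarter]
    exact Or.inr rfl
  have e2 : wp τ (cls τ (τ / 2 + 1 / 4) + cls τ (1 / 2)) = wp τ (cls τ (τ / 2 + 1 / 4)) := by
    have : cls τ (τ / 2 + 1 / 4) + cls τ (1 / 2) = - cls τ (τ / 2 + 1 / 4) := by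
      rw [← cls_add, ← cls_neg,
        cls_quarter_eq_iff 3 2 (-1) (-2) (by push_cast; ring) (by push_cast; ring)]; decide
    rw [this, wp_eq_iff (neg_ne_zero.mpr pole_ne_zero) pole_ne_zero]
    exact Or.inr rfl
  rw [e1] at q1
  rw [e2] at q2
  rw [add_comm (cls τ (τ / 2))] at q3
  refine ⟨?_, by linear_combination q3 - q1⟩
  apply mul_left_cancel₀ (sub_ne_zero.mpr (wp_zero_ne_wp_pole (τ := τ)))
  linear_combination q1 - q2

lemma legendre_half : legendre τ (cls τ (1 / 2)) = -1 := by
  rw [legendre_of_ne_zero half_ne_zero, div_eq_iff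
    (wp_sub_pole_ne_zero half_ne_zero (legendreDen_ne_zero_of_two_smul two_smul_half))]
  linear_combination -(wp_half_relations (τ := τ)).1

lemma legendre_half_tau : legendre τ (cls τ (τ / 2)) = a τ := rfl

lemma a_eq : a τ = (wp τ (cls τ (τ / 2)) - wp τ (cls τ (1 / 4))) /
    (wp τ (cls τ (τ / 2)) - wp τ (cls τ (τ / 2 + 1 / 4))) :=
  legendre_of_ne_zero half_tau_ne_zero

lemma half_tau_sub_pole_ne_zero :
    wp τ (cls τ (τ / 2)) - wp τ (cls τ (τ / 2 + 1 / 4)) ≠ 0 :=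
  wp_sub_pole_ne_zero half_tau_ne_zero (legendreDen_ne_zero_of_two_smul two_smul_half_tau)

lemma legendre_half_add_half_tau : legendre τ (cls τ (1 / 2) + cls τ (τ / 2)) = -a τ := by
  have h1 := wp_sub_pole_ne_zero half_add_half_tau_ne_zero
    (legendreDen_ne_zero_of_two_smul (two_smul_half_add_half_tau (τ := τ)))
  have h2 := half_tau_sub_pole_ne_zero (τ := τ)
  obtain ⟨r1, r2⟩ := wp_half_relations (τ := τ)
  rw [legendre_of_ne_zero half_add_half_tau_ne_zero, a_eq, ← neg_div, div_eq_div_iff h1 h2]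
  generalize wp τ (cls τ (τ / 2)) = u at *
  generalize wp τ (cls τ (1 / 2) + cls τ (τ / 2)) = v at *
  generalize wp τ (cls τ (1 / 4)) = q at *
  generalize wp τ (cls τ (1 / 2)) = e at *
  have hr : wp τ (cls τ (τ / 2 + 1 / 4)) = 2 * e - q := by linear_combination r1
  rw [hr]
  linear_combination 2 * r2

lemma a_ne_zero : a τ ≠ 0 := by
  rw [a_eq]
  exact div_ne_zero (wp_sub_zero_ne_zero half_tau_ne_zero
    (legendreNum_ne_zero_of_two_smul two_smul_half_tau)) half_tau_sub_pole_ne_zero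

lemma a_ne_one : a τ ≠ 1 := by
  rw [a_eq, ne_eq, div_eq_one_iff_eq half_tau_sub_pole_ne_zero]
  intro h
  exact wp_zero_ne_wp_pole (sub_right_injective h)

lemma a_ne_neg_one : a τ ≠ -1 := by
  rw [a_eq, ne_eq, div_eq_iff half_tau_sub_pole_ne_zero]
  intro h
  have h1 : wp τ (cls τ (τ / 2)) = wp τ (cls τ (1 / 2)) := by
    linear_combination (1 / 2) * h + (1 / 2) * (wp_half_relations (τ := τ)).1
  rw [wp_eq_iff half_tau_ne_zero half_ne_zero, neg_eq_self_of_two_smul two_smul_half, or_self] at h1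
  exact half_ne_half_tau h1.symm

lemma quarter_tau_ne_zero : cls τ (τ / 4) ≠ 0 := by
  rw [ne_eq, cls_quarter_eq_zero_iff 0 1 (by push_cast; ring)]; decide

/-- Translation by `τ/2` carries the zero `1/4` to the pole `τ/2 + 1/4`, and `τ/4` to its negative.
With `u = ℘(τ/2)` this gives `(q - u)(r - u) = (s - u)²` for the values `q`, `r`, `s` of `℘` at
these three points. -/
lemma b_sq : b τ ^ 2 = a τ := by
  obtain ⟨K, hK⟩ := wp_add_half (τ := τ) half_tau_ne_zero two_smul_half_tau
  have q1 := hK (cls τ (1 / 4)) zero_ne_quarter (by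
    rw [ne_eq, cls_quarter_eq_iff 1 0 0 2 (by push_cast; ring) (by push_cast; ring)]; decide)
  have q2 := hK (cls τ (τ / 4)) quarter_tau_ne_zero (by
    rw [ne_eq, cls_quarter_eq_iff 0 1 0 2 (by push_cast; ring) (by push_cast; ring)]; decide)
  have e1 : cls τ (1 / 4) + cls τ (τ / 2) = cls τ (τ / 2 + 1 / 4) := by rw [cls_add, add_comm]
  have e2 : wp τ (cls τ (τ / 4) + cls τ (τ / 2)) = wp τ (cls τ (τ / 4)) := by
    have : cls τ (τ / 4) + cls τ (τ / 2) = - cls τ (τ / 4) := by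
      rw [← cls_add, ← cls_neg,
        cls_quarter_eq_iff 0 3 0 (-1) (by push_cast; ring) (by push_cast; ring)]; decide
    rw [this, wp_eq_iff (neg_ne_zero.mpr quarter_tau_ne_zero) quarter_tau_ne_zero]
    exact Or.inr rfl
  rw [e1] at q1
  rw [e2] at q2
  have h1 : wp τ (cls τ (τ / 4)) - wp τ (cls τ (τ / 2 + 1 / 4)) ≠ 0 := by
    rw [sub_ne_zero, ne_eq, wp_eq_iff quarter_tau_ne_zero pole_ne_zero, ← cls_neg,
      cls_quarter_eq_iff 0 1 1 2 (by push_cast; ring) (by push_cast; ring),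
      cls_quarter_eq_iff 0 1 (-1) (-2) (by push_cast; ring) (by push_cast; ring)]
    decide
  have h2 := half_tau_sub_pole_ne_zero (τ := τ)
  rw [b, legendre_of_ne_zero quarter_tau_ne_zero, a_eq, div_pow, div_eq_div_iff (pow_ne_zero 2 h1) h2]
  generalize wp τ (cls τ (τ / 2)) = u at *
  generalize wp τ (cls τ (τ / 4)) = s at *
  generalize wp τ (cls τ (1 / 4)) = q at *
  generalize wp τ (cls τ (τ / 2 + 1 / 4)) = r at *
  linear_combination (q - r) * (q2 - q1)

lemma b_ne_zero : b τ ≠ 0 := fun h => a_ne_zero (τ := τ) (by rw [← b_sq, h]; simp)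

/-! ### Local representations of the Legendre function -/

/-- `(N : D)` is a holomorphic representation of the Legendre function near `z`; its Wronskian
has at most a simple zero at `z`, and vanishes there iff `z` is a branch point. -/
structure LocalRep (τ : ℍ) (z : ℂ) (N D : ℂ → ℂ) : Prop where
  num : AnalyticAt ℂ N z
  den : AnalyticAt ℂ D z
  num_eq : N z = legendreNum τ (cls τ z)
  den_eq : D z = legendreDen τ (cls τ z)
  scale : ∀ᶠ w in 𝓝 z, ∃ k : ℂ, k ≠ 0 ∧ legendreNum τ (cls τ w) = k * N w ∧
    legendreDen τ (cls τ w) = k * D w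
  wronskian : deriv N z * D z - N z * deriv D z = 0 ↔ 2 • cls τ z = 0
  second : 2 • cls τ z = 0 → deriv (deriv N) z * D z - N z * deriv (deriv D) z ≠ 0

/-- At a lattice point `z`, the function `(w - z)²(℘ w - c)` extends holomorphically in this form.
-/
lemma deriv_sq_mul_add_one {f : ℂ → ℂ} {z : ℂ} (hf : AnalyticAt ℂ f z) :
    deriv (fun w => (w - z) ^ 2 * f w + 1) z = 0 ∧
      deriv (deriv fun w => (w - z) ^ 2 * f w + 1) z = 2 * f z := by
  have h1 : deriv (fun w => (w - z) ^ 2 * f w + 1) =ᶠ[𝓝 z]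
      fun w => (w - z) * (2 * f w + (w - z) * deriv f w) := by
    filter_upwards [hf.eventually_analyticAt] with w hw
    have e1 : HasDerivAt (fun w => (w - z) ^ 2) (2 * (w - z)) w := by
      simpa using ((hasDerivAt_id w).sub_const z).fun_pow 2
    rw [((e1.fun_mul hw.differentiableAt.hasDerivAt).add_const 1).deriv]
    ring
  refine ⟨by rw [h1.self_of_nhds]; simp, ?_⟩
  rw [h1.deriv_eq]
  have e2 : HasDerivAt (fun w => w - z) 1 z := (hasDerivAt_id z).sub_const z
  have e3 : DifferentiableAt ℂ (fun w => 2 * f w + (w - z) * deriv f w) z := by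
    have := hf.differentiableAt
    have := hf.deriv.differentiableAt
    fun_prop
  rw [(e2.fun_mul e3.hasDerivAt).deriv]
  simp

/-- Off the lattice take `℘ - q` and `℘ - r`, whose Wronskian is `(q - r)℘'`. At a lattice point
multiply both by `(w - z)²`: they become `1` with vanishing first derivative, and their second
derivatives differ by `2(r - q)`. -/
lemma exists_localRep (z : ℂ) : ∃ N D, LocalRep τ z N D := by
  set L := periods τ with hL
  set q := wp τ (cls τ (1 / 4)) with hq
  set r := wp τ (cls τ (τ / 2 + 1 / 4)) with hr
  have hqr : q - r ≠ 0 := sub_ne_zero.mpr wp_zero_ne_wp_pole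
  by_cases hz : z ∈ L.lattice
  · have hz0 : cls τ z = 0 := cls_eq_zero_iff.mpr hz
    -- The term `1 / z ^ 2` belongs to the summand of `z` in the Weierstrass series; at `z = 0` it
    -- is `0` by the convention for division.
    set f := fun (c w : ℂ) => weierstrassPExcept L z w - (1 / z ^ 2 + c) with hf
    have hfa : ∀ c, AnalyticAt ℂ (f c) z := fun c =>
      (L.analyticAt_weierstrassPExcept z).sub analyticAt_const
    have hNa : ∀ c, AnalyticAt ℂ (fun w => (w - z) ^ 2 * f c w + 1) z := fun c => by
      have := hfa c
      fun_prop
    refine ⟨fun w => (w - z) ^ 2 * f q w + 1, fun w => (w - z) ^ 2 * f r w + 1, hNa q, hNa r,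
      by simp [hz0, legendreNum], by simp [hz0, legendreDen], ?_, ?_, fun _ => ?_⟩
    · filter_upwards [eventually_notMem_lattice_diff L z] with w hw
      by_cases hwz : w = z
      · exact ⟨1, one_ne_zero, by simp [hwz, hz0, legendreNum], by simp [hwz, hz0, legendreDen]⟩
      · have hwL : w ∉ L.lattice := fun h => hw ⟨h, hwz⟩
        have hw0 : cls τ w ≠ 0 := fun h => hwL (cls_eq_zero_iff.mp h)
        have hwz' : w - z ≠ 0 := sub_ne_zero.mpr hwz
        have h1 := L.weierstrassPExcept_add ⟨z, hz⟩ w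
        have key : ∀ c, weierstrassP L w - c = 1 / (w - z) ^ 2 * ((w - z) ^ 2 * f c w + 1) := by
          intro c
          simp only [hf]
          rw [← h1]
          rw [mul_add, ← mul_assoc, one_div_mul_cancel (pow_ne_zero 2 hwz')]
          ring
        refine ⟨1 / (w - z) ^ 2, by simp [hwz'], ?_, ?_⟩
        · rw [legendreNum, if_neg hw0, ← hq, wp_cls]; exact key q
        · rw [legendreDen, if_neg hw0, ← hr, wp_cls]; exact key r
    · rw [(deriv_sq_mul_add_one (hfa q)).1, (deriv_sq_mul_add_one (hfa r)).1]
      simp [hz0]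
    · rw [(deriv_sq_mul_add_one (hfa q)).2, (deriv_sq_mul_add_one (hfa r)).2]
      simp only [hf, sub_self, ne_eq, OfNat.ofNat_ne_zero, not_false_eq_true, zero_pow, zero_mul,
        zero_add, mul_one, one_mul]
      intro h
      exact hqr (by linear_combination (-1 / 2) * h)
  · have hz0 : cls τ z ≠ 0 := fun h => hz (cls_eq_zero_iff.mp h)
    have hpa := L.analyticOnNhd_weierstrassP z hz
    have hd : ∀ c, deriv (fun w => weierstrassP L w - c) = derivWeierstrassP L := fun c => by
      funext w; rw [deriv_sub_const, L.deriv_weierstrassP]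
    refine ⟨fun w => weierstrassP L w - q, fun w => weierstrassP L w - r,
      hpa.sub analyticAt_const, hpa.sub analyticAt_const,
      by rw [legendreNum, if_neg hz0, wp_cls], by rw [legendreDen, if_neg hz0, wp_cls], ?_, ?_, ?_⟩
    · filter_upwards [eventually_notMem_lattice L hz] with w hw
      have hw0 : cls τ w ≠ 0 := fun h => hw (cls_eq_zero_iff.mp h)
      exact ⟨1, one_ne_zero, by rw [legendreNum, if_neg hw0, wp_cls, one_mul],
        by rw [legendreDen, if_neg hw0, wp_cls, one_mul]⟩
    · rw [hd, hd, two_smul_cls, cls_eq_zero_iff, ← derivWeierstrassP_eq_zero_iff hz]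
      refine ⟨fun h => ?_, fun h => by rw [h]; ring⟩
      apply mul_right_cancel₀ hqr
      linear_combination h
    · intro h
      rw [two_smul_cls, cls_eq_zero_iff] at h
      rw [hd, hd]
      intro h0
      refine mul_ne_zero (deriv_derivWeierstrassP_ne_zero hz h) hqr ?_
      linear_combination h0

end Legendre

/-! ### Nodes are singular points -/

section Nodes

variable {V : Type*} [NormedAddCommGroup V] [NormedSpace ℂ V]

/-- Second order Taylor expansion at a critical point. -/
lemma taylor_critical {f : V → ℂ} {z : V} (hf : AnalyticAt ℂ f z) (h0 : f z = 0)
    (h1 : fderiv ℂ f z = 0) :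
    (fun h => f (z + h) - (1 / 2 : ℂ) * fderiv ℂ (fderiv ℂ f) z h h) =o[𝓝 0] fun h => ‖h‖ ^ 2 := by
  set Q := fderiv ℂ (fderiv ℂ f) z with hQ
  have hsymm : ∀ v w, Q v w = Q w v := fun v w =>
    ((hf.contDiffAt (n := ⊤)).isSymmSndFDerivAt (by simp [minSmoothness_of_isRCLikeNormedField])).eq
      v w
  have hQd : HasFDerivAt (fderiv ℂ f) Q z := hf.fderiv.differentiableAt.hasFDerivAt
  rw [hasFDerivAt_iff_isLittleO_nhds_zero] at hQd
  simp only [h1, sub_zero] at hQd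
  have hdiff : ∀ᶠ h in 𝓝 (0 : V), DifferentiableAt ℂ f (z + h) := by
    have h2 : Tendsto (fun h => z + h) (𝓝 0) (𝓝 z) := by
      simpa using (continuous_const.add continuous_id).tendsto (0 : V) (f := fun h => z + h)
    exact h2.eventually (hf.eventually_analyticAt.mono fun _ h => h.differentiableAt)
  rw [Asymptotics.isLittleO_iff]
  intro ε hε
  obtain ⟨δ, hδ, hball⟩ := Metric.eventually_nhds_iff_ball.mp
    (hdiff.and ((Asymptotics.isLittleO_iff.mp hQd) hε))
  filter_upwards [ball_mem_nhds (0 : V) hδ] with h hh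
  have hsub : ∀ x ∈ closedBall (0 : V) ‖h‖, x ∈ ball (0 : V) δ := fun x hx => by
    simp only [mem_closedBall, dist_zero_right, mem_ball] at hx hh ⊢
    exact hx.trans_lt hh
  -- By symmetry of `Q` the derivative of the remainder is `fderiv ℂ f (z + x) - Q x`, which is
  -- `o(‖x‖)`; the mean value inequality then gains one more order.
  have hderiv : ∀ x ∈ closedBall (0 : V) ‖h‖,
      HasFDerivWithinAt (fun h => f (z + h) - (1 / 2 : ℂ) * Q h h) (fderiv ℂ f (z + x) - Q x)
        (closedBall (0 : V) ‖h‖) x := by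
    intro x hx
    have e1 : HasFDerivAt (fun h => f (z + h)) (fderiv ℂ f (z + x)) x := by
      have := (hball x (hsub x hx)).1.hasFDerivAt
      simpa using! this.comp x ((hasFDerivAt_id x).const_add z)
    have e2 : HasFDerivAt (fun h => Q h h) (Q x + Q.flip x) x := by
      have := (Q.hasFDerivAt (x := x)).clm_apply (hasFDerivAt_id x)
      refine this.congr_fderiv ?_
      ext y
      simp
    refine (e1.sub (e2.const_mul (1 / 2 : ℂ))).hasFDerivWithinAt.congr_fderiv ?_
    ext y
    simp only [_root_.sub_apply, _root_.smul_apply,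
      _root_.add_apply, ContinuousLinearMap.flip_apply, smul_eq_mul, hsymm y x]
    ring
  have hbound : ∀ x ∈ closedBall (0 : V) ‖h‖, ‖fderiv ℂ f (z + x) - Q x‖ ≤ ε * ‖h‖ := by
    intro x hx
    refine ((hball x (hsub x hx)).2).trans ?_
    simp only [mem_closedBall, dist_zero_right] at hx
    gcongr
  have := (convex_closedBall (0 : V) ‖h‖).norm_image_sub_le_of_norm_hasFDerivWithin_le
    hderiv hbound (x := 0) (y := h) (by simp) (by simp)
  simp only [add_zero, h0, map_zero, mul_zero, sub_zero] at this
  simpa [pow_two, mul_assoc] using this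

/-- If a function with a critical point at `z` vanishes on a smooth hypersurface through `z`, then
the Hessian is isotropic on the tangent space of that hypersurface. -/
lemma hessian_isotropic [FiniteDimensional ℂ V] {f g : V → ℂ} {z : V} (hf : AnalyticAt ℂ f z)
    (h0 : f z = 0) (h1 : fderiv ℂ f z = 0) (hg : AnalyticAt ℂ g z) (hg0 : g z = 0)
    (hg1 : fderiv ℂ g z ≠ 0) (hfg : ∀ᶠ w in 𝓝 z, g w = 0 → f w = 0) {k : V}
    (hk : fderiv ℂ g z k = 0) : fderiv ℂ (fderiv ℂ f) z k k = 0 := by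
  set ℓ := fderiv ℂ g z with hℓ
  set Q := fderiv ℂ (fderiv ℂ f) z with hQ
  have : CompleteSpace V := FiniteDimensional.complete ℂ V
  have hs : HasStrictFDerivAt g ℓ z := hg.hasStrictFDerivAt
  have hr : ℓ.range = ⊤ := by
    refine LinearMap.range_eq_top.mpr (LinearMap.surjective ?_)
    intro h
    exact hg1 (ContinuousLinearMap.coe_injective h)
  set φ : ℓ.ker → V := hs.implicitFunction g ℓ hr (g z) with hφ
  let k' : ℓ.ker := ⟨k, hk⟩
  have hφ0 : φ 0 = z := hs.implicitFunction_apply_image hr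
  have hφd : HasFDerivAt φ ℓ.ker.subtypeL 0 := (hs.to_implicitFunction hr).hasFDerivAt
  have hline : HasDerivAt (fun t : ℂ => t • k') k' 0 := by
    simpa using (hasDerivAt_id (0 : ℂ)).smul_const k'
  have hpath : HasDerivAt (fun t : ℂ => φ (t • k')) k 0 := by
    have := HasFDerivAt.comp_hasDerivAt (0 : ℂ) (l := φ) (f := fun t : ℂ => t • k')
      (l' := ℓ.ker.subtypeL) (by simpa using hφd) hline
    simpa using! this
  have hcont : Tendsto (fun t : ℂ => φ (t • k')) (𝓝 0) (𝓝 z) := by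
    have := hpath.continuousAt.tendsto
    simpa [hφ0] using this
  have hgz : ∀ᶠ t : ℂ in 𝓝 0, g (φ (t • k')) = 0 := by
    have h2 : Tendsto (fun t : ℂ => ((g z, t • k') : ℂ × ℓ.ker)) (𝓝 0) (𝓝 (g z, 0)) := by
      have := hline.continuousAt.tendsto
      rw [zero_smul] at this
      exact tendsto_const_nhds.prodMk_nhds this
    filter_upwards [h2.eventually (hs.map_implicitFunction_eq hr)] with t ht
    rw [hφ]
    rw [ht, hg0]
  have hfz : ∀ᶠ t : ℂ in 𝓝 0, f (φ (t • k')) = 0 := by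
    filter_upwards [hgz, hcont.eventually hfg] with t h2 h3
    exact h3 h2
  have hslope : Tendsto (fun t : ℂ => t⁻¹ • (φ (t • k') - z)) (𝓝[≠] 0) (𝓝 k) := by
    have := hasDerivAt_iff_tendsto_slope.mp hpath
    refine this.congr fun t => ?_
    simp [slope, hφ0]
  have hdiff0 : Tendsto (fun t : ℂ => φ (t • k') - z) (𝓝[≠] 0) (𝓝 0) := by
    simpa using (hcont.sub_const z).mono_left nhdsWithin_le_nhds
  have hT := (taylor_critical hf h0 h1).comp_tendsto hdiff0
  have hQlim : Tendsto (fun t : ℂ => Q (t⁻¹ • (φ (t • k') - z)) (t⁻¹ • (φ (t • k') - z)))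
      (𝓝[≠] 0) (𝓝 (Q k k)) :=
    (Q.continuous₂.tendsto (k, k)).comp (hslope.prodMk_nhds hslope)
  have hO : (fun t : ℂ => ‖φ (t • k') - z‖ ^ 2) =O[𝓝[≠] 0] fun t : ℂ => t ^ 2 := by
    have h2 : (fun t : ℂ => φ (t • k') - z) =O[𝓝 0] fun t : ℂ => t := by
      have := hpath.isBigO_sub
      simpa [hφ0] using this
    exact (h2.norm_left.pow 2).mono nhdsWithin_le_nhds
  have hlim0 : Tendsto (fun t : ℂ => Q (t⁻¹ • (φ (t • k') - z)) (t⁻¹ • (φ (t • k') - z)))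
      (𝓝[≠] 0) (𝓝 0) := by
    have h3 := ((hT.trans_isBigO hO).tendsto_div_nhds_zero).const_mul (-2)
    rw [mul_zero] at h3
    refine h3.congr' ?_
    filter_upwards [self_mem_nhdsWithin, mem_nhdsWithin_of_mem_nhds hfz] with t ht hft
    have ht' : t ≠ 0 := ht
    simp only [Function.comp_apply, add_sub_cancel, hft, map_smul, _root_.smul_apply,
      smul_eq_mul]
    field_simp
    ring
  exact tendsto_nhds_unique hQlim hlim0

/-- The zero locus of a function with a nondegenerate critical point in dimension at least three is
not a smooth hypersurface. -/
lemma exists_hessian_kernel [FiniteDimensional ℂ V] (hdim : 3 ≤ Module.finrank ℂ V) {f g : V → ℂ}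
    {z : V} (hf : AnalyticAt ℂ f z) (h0 : f z = 0) (h1 : fderiv ℂ f z = 0) (hg : AnalyticAt ℂ g z)
    (hg0 : g z = 0) (hg1 : fderiv ℂ g z ≠ 0) (hfg : ∀ᶠ w in 𝓝 z, g w = 0 → f w = 0) :
    ∃ v ≠ 0, ∀ w, fderiv ℂ (fderiv ℂ f) z v w = 0 := by
  set ℓ := fderiv ℂ g z with hℓ
  set Q := fderiv ℂ (fderiv ℂ f) z with hQ
  have hsymm : ∀ v w, Q v w = Q w v := fun v w =>
    ((hf.contDiffAt (n := ⊤)).isSymmSndFDerivAt (by simp [minSmoothness_of_isRCLikeNormedField])).eq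
      v w
  have hiso : ∀ k, ℓ k = 0 → Q k k = 0 := fun k hk => hessian_isotropic hf h0 h1 hg hg0 hg1 hfg hk
  have hpol : ∀ k k', ℓ k = 0 → ℓ k' = 0 → Q k k' = 0 := by
    intro k k' hk hk'
    have e := hiso (k + k') (by rw [map_add, hk, hk', add_zero])
    simp only [map_add, _root_.add_apply, hiso k hk, hiso k' hk', hsymm k' k] at e
    linear_combination (1 / 2) * e
  obtain ⟨e, he⟩ : ∃ e, ℓ e ≠ 0 := by
    by_contra! h
    exact hg1 (ContinuousLinearMap.ext h)
  -- `Q` vanishes on `ker ℓ × ker ℓ` and `dim ker ℓ ≥ 2`, so some nonzero `v ∈ ker ℓ` is also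
  -- orthogonal to `e`, hence to all of `V`.
  let ψ : ℓ.ker →ₗ[ℂ] ℂ := ((Q.flip e : V →L[ℂ] ℂ) : V →ₗ[ℂ] ℂ).comp ℓ.ker.subtype
  have hrank : Module.finrank ℂ ℂ < Module.finrank ℂ ℓ.ker := by
    have h2 := (ℓ : V →ₗ[ℂ] ℂ).finrank_range_add_finrank_ker
    have h3 : Module.finrank ℂ (ℓ : V →ₗ[ℂ] ℂ).range ≤ Module.finrank ℂ ℂ :=
      Submodule.finrank_le _
    rw [Module.finrank_self] at h3 ⊢
    have h4 : 2 ≤ Module.finrank ℂ (ℓ : V →ₗ[ℂ] ℂ).ker := by omega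
    exact h4
  obtain ⟨⟨v, hv⟩, hvψ, hv0⟩ :=
    (Submodule.ne_bot_iff _).mp (LinearMap.ker_ne_bot_of_finrank_lt (f := ψ) hrank)
  refine ⟨v, fun h => hv0 (Subtype.ext h), fun w => ?_⟩
  have hve : Q v e = 0 := by simpa [ψ] using hvψ
  have hvℓ : ℓ v = 0 := hv
  have hdecomp : w = (w - (ℓ w / ℓ e) • e) + (ℓ w / ℓ e) • e := by abel
  have hker : ℓ (w - (ℓ w / ℓ e) • e) = 0 := by
    rw [map_sub, map_smul, smul_eq_mul, div_mul_cancel₀ _ he, sub_self]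
  rw [hdecomp, map_add, hpol v _ hvℓ hker, map_smul, hve, smul_zero, add_zero]

lemma proj_eq_proj_iff {τ : Fin 3 → ℍ} {z w : Fin 3 → ℂ} :
    proj τ z = proj τ w ↔ ∀ j, z j - w j ∈ (periods (τ j)).lattice := by
  simp only [proj, funext_iff, cls_eq_iff]

/-- The two local equations share only their zero set and may live at different lifts of `p`. After
translation by the lattice vector `z' - z`, `exists_hessian_kernel` contradicts nondegeneracy. -/
theorem IsNode.not_isSmoothAt {τ : Fin 3 → ℍ} {X : Set (Torus τ)} {p : Torus τ}
    (h : IsNode X p) : ¬ IsSmoothAt X p := by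
  rintro ⟨z', hz', g, hg, hg1, hgX⟩
  obtain ⟨z, hz, f, hf, h0, h1, hnd, hfX⟩ := h
  have hlat := proj_eq_proj_iff.mp (hz'.trans hz.symm)
  have hper : ∀ w : Fin 3 → ℂ, proj τ (w + (z' - z)) = proj τ w := fun w =>
    proj_eq_proj_iff.mpr fun j => by simpa using hlat j
  set g' : (Fin 3 → ℂ) → ℂ := fun w => g (w + (z' - z)) with hg'
  have hg'a : AnalyticAt ℂ g' z :=
    AnalyticAt.fun_comp (f := fun w : Fin 3 → ℂ => w + (z' - z)) (by simpa using hg) (by fun_prop)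
  have hshift : Tendsto (fun w : Fin 3 → ℂ => w + (z' - z)) (𝓝 z) (𝓝 z') := by
    have : ContinuousAt (fun w : Fin 3 → ℂ => w + (z' - z)) z := by fun_prop
    simpa [ContinuousAt] using this
  have hiff : ∀ᶠ w in 𝓝 z, (f w = 0 ↔ g' w = 0) := by
    filter_upwards [hfX, hshift.eventually hgX] with w hw hw'
    rw [← hw, ← hw', hper]
  have hg'1 : fderiv ℂ g' z ≠ 0 := by
    rw [hg', fderiv_comp_add_right]
    simpa using hg1
  obtain ⟨v, hv, hvw⟩ := exists_hessian_kernel (by simp) hf h0 h1 hg'a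
    (hiff.self_of_nhds.mp h0) hg'1 (hiff.mono fun _ h => h.mpr)
  exact hv (hnd v hvw)

end Nodes

/-! ### Hypersurfaces given by a sum of two products -/

section ProdSum

/-- The function `u₀(w₀) u₁(w₁) u₂(w₂) + c v₀(w₀) v₁(w₁) v₂(w₂)`. -/
def prodSum (u v : Fin 3 → ℂ → ℂ) (c : ℂ) (w : Fin 3 → ℂ) : ℂ :=
  u 0 (w 0) * u 1 (w 1) * u 2 (w 2) + c * (v 0 (w 0) * v 1 (w 1) * v 2 (w 2))

/-- The family `u` with its `j`-th member differentiated. -/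
def derivAt (u : Fin 3 → ℂ → ℂ) (j : Fin 3) : Fin 3 → ℂ → ℂ :=
  Function.update u j (deriv (u j))

/-- The coordinate functions of `ℂ³`. -/
abbrev dx (j : Fin 3) : (Fin 3 → ℂ) →L[ℂ] ℂ := ContinuousLinearMap.proj j

variable {u v : Fin 3 → ℂ → ℂ} {c : ℂ} {z : Fin 3 → ℂ}

lemma derivAt_analytic (hu : ∀ j, AnalyticAt ℂ (u j) (z j)) (i j : Fin 3) :
    AnalyticAt ℂ (derivAt u i j) (z j) := by
  by_cases h : j = i
  · subst h; simpa [derivAt] using (hu j).deriv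
  · simpa [derivAt, h] using hu j

lemma prodSum_analyticAt (hu : ∀ j, AnalyticAt ℂ (u j) (z j)) (hv : ∀ j, AnalyticAt ℂ (v j) (z j)) :
    AnalyticAt ℂ (prodSum u v c) z := by
  have hp : ∀ j : Fin 3, AnalyticAt ℂ (fun w : Fin 3 → ℂ => w j) z := fun j =>
    (dx j).analyticAt z
  have hu' : ∀ j, AnalyticAt ℂ (fun w : Fin 3 → ℂ => u j (w j)) z := fun j =>
    AnalyticAt.fun_comp (hu j) (hp j)
  have hv' : ∀ j, AnalyticAt ℂ (fun w : Fin 3 → ℂ => v j (w j)) z := fun j =>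
    AnalyticAt.fun_comp (hv j) (hp j)
  exact (((hu' 0).fun_mul (hu' 1)).fun_mul (hu' 2)).fun_add
    (analyticAt_const.fun_mul (((hv' 0).fun_mul (hv' 1)).fun_mul (hv' 2)))

lemma prodSum_hasFDerivAt (hu : ∀ j, AnalyticAt ℂ (u j) (z j))
    (hv : ∀ j, AnalyticAt ℂ (v j) (z j)) :
    HasFDerivAt (prodSum u v c) (∑ j, prodSum (derivAt u j) (derivAt v j) c z •
      dx j) z := by
  have key : ∀ (f : Fin 3 → ℂ → ℂ), (∀ j, AnalyticAt ℂ (f j) (z j)) → ∀ j,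
      HasFDerivAt (fun w : Fin 3 → ℂ => f j (w j)) (deriv (f j) (z j) •
        dx j) z := fun f hf j =>
    (hf j).differentiableAt.hasDerivAt.comp_hasFDerivAt (f := fun w : Fin 3 → ℂ => w j) z
      (dx j).hasFDerivAt
  have ku := key u hu
  have kv := key v hv
  refine ((((ku 0).fun_mul (ku 1)).fun_mul (ku 2)).fun_add
    ((((kv 0).fun_mul (kv 1)).fun_mul (kv 2)).const_mul c)).congr_fderiv ?_
  ext y
  simp [Fin.sum_univ_three, prodSum, derivAt]
  ring

lemma fderiv_prodSum_eq_zero_iff (hu : ∀ j, AnalyticAt ℂ (u j) (z j))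
    (hv : ∀ j, AnalyticAt ℂ (v j) (z j)) :
    fderiv ℂ (prodSum u v c) z = 0 ↔ ∀ j, prodSum (derivAt u j) (derivAt v j) c z = 0 := by
  rw [(prodSum_hasFDerivAt hu hv).fderiv]
  refine ⟨fun h j => ?_, fun h => Finset.sum_eq_zero fun j _ => by
    rw [h]; exact zero_smul ℂ (dx j)⟩
  have := congrArg (fun L : (Fin 3 → ℂ) →L[ℂ] ℂ => L (Pi.single j 1)) h
  simpa [Pi.single_apply] using this

/-- Partial derivatives of a `prodSum` are again of this shape, so all Hessian entries, the diagonal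
ones included, come from applying `derivAt` twice. -/
lemma hessian_prodSum (hu : ∀ j, AnalyticAt ℂ (u j) (z j))
    (hv : ∀ j, AnalyticAt ℂ (v j) (z j)) (x : Fin 3 → ℂ) (j : Fin 3) :
    fderiv ℂ (fderiv ℂ (prodSum u v c)) z x (Pi.single j 1) =
      ∑ k, prodSum (derivAt (derivAt u j) k) (derivAt (derivAt v j) k) c z * x k := by
  have hev : fderiv ℂ (prodSum u v c) =ᶠ[𝓝 z] fun w =>
      ∑ j, prodSum (derivAt u j) (derivAt v j) c w •
        dx j := by
    have hcoord : ∀ (f : Fin 3 → ℂ → ℂ), (∀ j, AnalyticAt ℂ (f j) (z j)) →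
        ∀ᶠ w : Fin 3 → ℂ in 𝓝 z, ∀ j, AnalyticAt ℂ (f j) (w j) := fun f hf =>
      eventually_all.mpr fun j =>
        (continuous_apply j).continuousAt.eventually (hf j).eventually_analyticAt
    filter_upwards [hcoord u hu, hcoord v hv] with w h1 h2
    exact (prodSum_hasFDerivAt h1 h2).fderiv
  have hd : HasFDerivAt (fun w => ∑ j, prodSum (derivAt u j) (derivAt v j) c w •
        dx j)
      (∑ j, (∑ k, prodSum (derivAt (derivAt u j) k) (derivAt (derivAt v j) k) c z •
        dx k).smulRight
        (dx j)) z :=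
    HasFDerivAt.fun_sum fun j _ => (prodSum_hasFDerivAt (derivAt_analytic hu j)
      (derivAt_analytic hv j)).smul_const (dx j)
  rw [hev.fderiv_eq, hd.fderiv]
  simp [Pi.single_apply]

/-- Local analysis of a hypersurface with an equation of the form `prodSum`. -/
lemma sing_prodSum {τ : Fin 3 → ℍ} {X : Set (Torus τ)} (hu : ∀ j, AnalyticAt ℂ (u j) (z j))
    (hv : ∀ j, AnalyticAt ℂ (v j) (z j)) (hX : ∀ᶠ w in 𝓝 z, (proj τ w ∈ X ↔ prodSum u v c w = 0))
    (hnd : prodSum u v c z = 0 → (∀ j, prodSum (derivAt u j) (derivAt v j) c z = 0) →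
      ∀ x : Fin 3 → ℂ, (∀ j, ∑ k, prodSum (derivAt (derivAt u j) k) (derivAt (derivAt v j) k) c z * x k
        = 0) → x = 0) :
    (proj τ z ∈ Sing X ↔
      prodSum u v c z = 0 ∧ ∀ j, prodSum (derivAt u j) (derivAt v j) c z = 0) ∧
    (proj τ z ∈ Sing X → IsNode X (proj τ z)) := by
  have hmem : proj τ z ∈ X ↔ prodSum u v c z = 0 := hX.self_of_nhds
  have han : AnalyticAt ℂ (prodSum u v c) z := prodSum_analyticAt hu hv
  have h1 : proj τ z ∈ Sing X →
      prodSum u v c z = 0 ∧ ∀ j, prodSum (derivAt u j) (derivAt v j) c z = 0 := by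
    rintro ⟨hzX, hns⟩
    refine ⟨hmem.mp hzX, ?_⟩
    rw [← fderiv_prodSum_eq_zero_iff hu hv]
    by_contra h
    exact hns ⟨z, rfl, _, han, h, hX⟩
  have h2 : prodSum u v c z = 0 ∧ (∀ j, prodSum (derivAt u j) (derivAt v j) c z = 0) →
      IsNode X (proj τ z) := fun ⟨e1, e2⟩ =>
    ⟨z, rfl, _, han, e1, (fderiv_prodSum_eq_zero_iff hu hv).mpr e2,
      fun x hx => hnd e1 e2 x fun j => by rw [← hessian_prodSum hu hv, hx], hX⟩
  exact ⟨⟨h1, fun h => ⟨hmem.mpr h.1, (h2 h).not_isSmoothAt⟩⟩, fun h => h2 (h1 h)⟩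

/-- Modulo the equation, the partial derivative times `v₀` is the Wronskian times `u₁u₂`, and times
`u₀` it is the Wronskian times `-c v₁v₂`. One of `u₀`, `v₀` can be cancelled. -/
lemma partial_eq_zero_iff {u₀ u₁ u₂ v₀ v₁ v₂ p q c : ℂ} (hc : c ≠ 0) (h : u₀ ≠ 0 ∨ v₀ ≠ 0)
    (hF : u₀ * u₁ * u₂ + c * (v₀ * v₁ * v₂) = 0) :
    p * u₁ * u₂ + c * (q * v₁ * v₂) = 0 ↔
      p * v₀ - u₀ * q = 0 ∨ (u₁ * u₂ = 0 ∧ v₁ * v₂ = 0) := by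
  have e1 : v₀ * (p * u₁ * u₂ + c * (q * v₁ * v₂)) = (p * v₀ - u₀ * q) * (u₁ * u₂) := by
    linear_combination q * hF
  have e2 : u₀ * (p * u₁ * u₂ + c * (q * v₁ * v₂)) = (p * v₀ - u₀ * q) * (-c * (v₁ * v₂)) := by
    linear_combination p * hF
  constructor
  · intro hP
    rw [hP, mul_zero] at e1 e2
    by_cases hW : p * v₀ - u₀ * q = 0
    · exact Or.inl hW
    · right
      refine ⟨(mul_eq_zero.mp e1.symm).resolve_left hW, ?_⟩
      simpa [hc] using (mul_eq_zero.mp e2.symm).resolve_left hW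
  · intro hW
    have f1 : v₀ * (p * u₁ * u₂ + c * (q * v₁ * v₂)) = 0 := by
      rw [e1]; rcases hW with hW | hW
      · rw [hW, zero_mul]
      · rw [hW.1, mul_zero]
    have f2 : u₀ * (p * u₁ * u₂ + c * (q * v₁ * v₂)) = 0 := by
      rw [e2]; rcases hW with hW | hW
      · rw [hW, zero_mul]
      · rw [hW.2, mul_zero, mul_zero]
    rcases h with h | h
    · exact (mul_eq_zero.mp f2).resolve_left h
    · exact (mul_eq_zero.mp f1).resolve_left h

/-- The Wronskian of `u j` and `v j` at `z j`. -/
def wr (u v : Fin 3 → ℂ → ℂ) (z : Fin 3 → ℂ) (j : Fin 3) : ℂ :=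
  deriv (u j) (z j) * v j (z j) - u j (z j) * deriv (v j) (z j)

/-- The derivative of the Wronskian of `u j` and `v j` at `z j`. -/
def wr' (u v : Fin 3 → ℂ → ℂ) (z : Fin 3 → ℂ) (j : Fin 3) : ℂ :=
  deriv (deriv (u j)) (z j) * v j (z j) - u j (z j) * deriv (deriv (v j)) (z j)

/-- The three ways in which `prodSum` can have a critical zero. -/
def IsCritical (u v : Fin 3 → ℂ → ℂ) (z : Fin 3 → ℂ) : Prop :=
  (∀ j, wr u v z j = 0 ∧ u j (z j) ≠ 0 ∧ v j (z j) ≠ 0) ∨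
    (wr u v z 0 = 0 ∧ v 0 (z 0) = 0 ∧ u 1 (z 1) = 0 ∧ u 2 (z 2) = 0) ∨
    (wr u v z 0 = 0 ∧ u 0 (z 0) = 0 ∧ v 1 (z 1) = 0 ∧ v 2 (z 2) = 0)

/-- Once `partial_eq_zero_iff` is applied to each coordinate, only propositional logic in the
vanishing of `u_j`, `v_j` and the Wronskians remains. Index `0` is exempt from `hW` because the
first pair of `Xnu` may vanish at branch points. -/
lemma critical_iff (hc : c ≠ 0) (hne : ∀ j, u j (z j) ≠ 0 ∨ v j (z j) ≠ 0)
    (hW : ∀ j ≠ 0, u j (z j) = 0 ∨ v j (z j) = 0 → wr u v z j ≠ 0) (hF : prodSum u v c z = 0) :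
    (∀ j, prodSum (derivAt u j) (derivAt v j) c z = 0) ↔ IsCritical u v z := by
  have n0 := hne 0
  have n1 := hne 1
  have n2 := hne 2
  have w1 := hW 1 (by decide)
  have w2 := hW 2 (by decide)
  have p0 := partial_eq_zero_iff (p := deriv (u 0) (z 0)) (q := deriv (v 0) (z 0)) hc n0 hF
  have p1 := partial_eq_zero_iff (p := deriv (u 1) (z 1)) (q := deriv (v 1) (z 1))
    (u₁ := u 0 (z 0)) (u₂ := u 2 (z 2)) (v₁ := v 0 (z 0)) (v₂ := v 2 (z 2)) hc n1
    (by rw [prodSum] at hF; linear_combination hF)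
  have p2 := partial_eq_zero_iff (p := deriv (u 2) (z 2)) (q := deriv (v 2) (z 2))
    (u₁ := u 0 (z 0)) (u₂ := u 1 (z 1)) (v₁ := v 0 (z 0)) (v₂ := v 1 (z 1)) hc n2
    (by rw [prodSum] at hF; linear_combination hF)
  have g0 : prodSum (derivAt u 0) (derivAt v 0) c z = 0 ↔
      wr u v z 0 = 0 ∨ (u 1 (z 1) * u 2 (z 2) = 0 ∧ v 1 (z 1) * v 2 (z 2) = 0) := by
    rw [wr, ← p0]; simp [prodSum, derivAt]
  have g1 : prodSum (derivAt u 1) (derivAt v 1) c z = 0 ↔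
      wr u v z 1 = 0 ∨ (u 0 (z 0) * u 2 (z 2) = 0 ∧ v 0 (z 0) * v 2 (z 2) = 0) := by
    rw [wr, ← p1]
    refine Eq.congr ?_ rfl
    simp only [prodSum, derivAt, Function.update_self, ne_eq, Fin.reduceEq, not_false_eq_true,
      Function.update_of_ne, zero_ne_one]
    ring
  have g2 : prodSum (derivAt u 2) (derivAt v 2) c z = 0 ↔
      wr u v z 2 = 0 ∨ (u 0 (z 0) * u 1 (z 1) = 0 ∧ v 0 (z 0) * v 1 (z 1) = 0) := by
    rw [wr, ← p2]
    refine Eq.congr ?_ rfl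
    simp only [prodSum, derivAt, Function.update_self, ne_eq, Fin.reduceEq, not_false_eq_true,
      Function.update_of_ne]
    ring
  have hF' : u 0 (z 0) * u 1 (z 1) * u 2 (z 2) + c * (v 0 (z 0) * v 1 (z 1) * v 2 (z 2)) = 0 := hF
  have hF1 : u 0 (z 0) = 0 → v 0 (z 0) * v 1 (z 1) * v 2 (z 2) = 0 := fun h => by
    rw [h] at hF'; simpa [hc] using hF'
  have hF2 : v 0 (z 0) = 0 → u 0 (z 0) * u 1 (z 1) * u 2 (z 2) = 0 := fun h => by
    rw [h] at hF'; simpa using hF'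
  have hall : ∀ P : Fin 3 → Prop, (∀ j, P j) ↔ P 0 ∧ P 1 ∧ P 2 := fun P => by
    simp [Fin.forall_fin_succ]
  simp only [IsCritical, hall, g0, g1, g2, mul_eq_zero, ne_eq] at hF1 hF2 n0 n1 n2 w1 w2 ⊢
  clear g0 g1 g2 p0 p1 p2 hF hF' hne hW hall
  generalize (u 0 (z 0) = 0) = U₀ at *
  generalize (u 1 (z 1) = 0) = U₁ at *
  generalize (u 2 (z 2) = 0) = U₂ at *
  generalize (v 0 (z 0) = 0) = V₀ at *
  generalize (v 1 (z 1) = 0) = V₁ at *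
  generalize (v 2 (z 2) = 0) = V₂ at *
  generalize (wr u v z 0 = 0) = W₀ at *
  generalize (wr u v z 1 = 0) = W₁ at *
  generalize (wr u v z 2 = 0) = W₂ at *
  constructor <;> grind (splits := 20)

/-- If all Wronskians vanish, the Hessian is diagonal with entries that are nonzero multiples of
`wr'`. In the other two cases it splits into a nonzero entry at index `0` and an antidiagonal block
in the indices `1`, `2`. -/
lemma hessian_nondegenerate (hc : c ≠ 0) (hne : ∀ j, u j (z j) ≠ 0 ∨ v j (z j) ≠ 0)
    (hW : ∀ j ≠ 0, u j (z j) = 0 ∨ v j (z j) = 0 → wr u v z j ≠ 0)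
    (hW' : ∀ j, wr u v z j = 0 → wr' u v z j ≠ 0) (hF : prodSum u v c z = 0)
    (hcrit : IsCritical u v z) (x : Fin 3 → ℂ)
    (hx : ∀ j, ∑ k, prodSum (derivAt (derivAt u j) k) (derivAt (derivAt v j) k) c z * x k = 0) :
    x = 0 := by
  have x0 := hx 0
  have x1 := hx 1
  have x2 := hx 2
  simp only [Fin.sum_univ_three, prodSum, derivAt, Function.update_self, ne_eq,
    Fin.reduceEq, not_false_eq_true, Function.update_of_ne, zero_ne_one, one_ne_zero] at x0 x1 x2
  have hF' : u 0 (z 0) * u 1 (z 1) * u 2 (z 2) + c * (v 0 (z 0) * v 1 (z 1) * v 2 (z 2)) = 0 := hF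
  have w1 := hW 1 (by decide)
  have w2 := hW 2 (by decide)
  have s0 := hW' 0
  have s1 := hW' 1
  have s2 := hW' 2
  have n0 := hne 0
  have n1 := hne 1
  have n2 := hne 2
  rw [IsCritical, Fin.forall_fin_succ, Fin.forall_fin_succ, Fin.forall_fin_succ] at hcrit
  simp only [Fin.succ_zero_eq_one, Fin.succ_one_eq_two, IsEmpty.forall_iff, and_true] at hcrit
  simp only [wr, wr'] at *
  generalize u 0 (z 0) = U₀ at *
  generalize u 1 (z 1) = U₁ at *
  generalize u 2 (z 2) = U₂ at *
  generalize v 0 (z 0) = V₀ at *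
  generalize v 1 (z 1) = V₁ at *
  generalize v 2 (z 2) = V₂ at *
  generalize deriv (deriv (u 0)) (z 0) = U₀'' at *
  generalize deriv (deriv (u 1)) (z 1) = U₁'' at *
  generalize deriv (deriv (u 2)) (z 2) = U₂'' at *
  generalize deriv (deriv (v 0)) (z 0) = V₀'' at *
  generalize deriv (deriv (v 1)) (z 1) = V₁'' at *
  generalize deriv (deriv (v 2)) (z 2) = V₂'' at *
  generalize deriv (u 0) (z 0) = U₀' at *
  generalize deriv (u 1) (z 1) = U₁' at *
  generalize deriv (u 2) (z 2) = U₂' at *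
  generalize deriv (v 0) (z 0) = V₀' at *
  generalize deriv (v 1) (z 1) = V₁' at *
  generalize deriv (v 2) (z 2) = V₂' at *
  suffices h : x 0 = 0 ∧ x 1 = 0 ∧ x 2 = 0 by
    funext j
    fin_cases j
    exacts [h.1, h.2.1, h.2.2]
  rcases hcrit with ⟨⟨W0, u0, v0⟩, ⟨W1, u1, v1⟩, ⟨W2, u2, v2⟩⟩ | ⟨W0, v0, u1, u2⟩ | ⟨W0, u0, v1, v2⟩
  · have h01 : U₀' * U₁' * U₂ + c * (V₀' * V₁' * V₂) = 0 := by
      apply mul_left_cancel₀ (mul_ne_zero v0 v1)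
      linear_combination U₁' * V₁ * U₂ * W0 + U₀ * V₀' * U₂ * W1 + V₀' * V₁' * hF'
    have h02 : U₀' * U₁ * U₂' + c * (V₀' * V₁ * V₂') = 0 := by
      apply mul_left_cancel₀ (mul_ne_zero v0 v2)
      linear_combination U₂' * V₂ * U₁ * W0 + U₀ * V₀' * U₁ * W2 + V₀' * V₂' * hF'
    have h12 : U₀ * U₁' * U₂' + c * (V₀ * V₁' * V₂') = 0 := by
      apply mul_left_cancel₀ (mul_ne_zero v1 v2)
      linear_combination U₂' * V₂ * U₀ * W1 + U₁ * V₁' * U₀ * W2 + V₁' * V₂' * hF'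
    refine ⟨?_, ?_, ?_⟩
    · apply (mul_eq_zero.mp _).resolve_left (mul_ne_zero (mul_ne_zero u1 u2) (s0 W0))
      linear_combination V₀ * x0 - V₀'' * x 0 * hF' - V₀ * x 1 * h01 - V₀ * x 2 * h02
    · apply (mul_eq_zero.mp _).resolve_left (mul_ne_zero (mul_ne_zero u0 u2) (s1 W1))
      linear_combination V₁ * x1 - V₁'' * x 1 * hF' - V₁ * x 0 * h01 - V₁ * x 2 * h12
    · apply (mul_eq_zero.mp _).resolve_left (mul_ne_zero (mul_ne_zero u0 u1) (s2 W2))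
      linear_combination V₂ * x2 - V₂'' * x 2 * hF' - V₂ * x 0 * h02 - V₂ * x 1 * h12
  · subst v0 u1 u2
    have nU0 : U₀ ≠ 0 := by simpa using n0
    have nV1 : V₁ ≠ 0 := by simpa using n1
    have nV2 : V₂ ≠ 0 := by simpa using n2
    obtain rfl : V₀' = 0 := by simpa [nU0] using W0
    have nU1' : U₁' ≠ 0 := by rintro rfl; simp at w1
    have nU2' : U₂' ≠ 0 := by rintro rfl; simp at w2
    have nV0'' : V₀'' ≠ 0 := by rintro rfl; simp at s0
    refine ⟨?_, ?_, ?_⟩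
    · apply (mul_eq_zero.mp _).resolve_left (mul_ne_zero (mul_ne_zero hc nV0'') (mul_ne_zero nV1 nV2))
      linear_combination x0
    · apply (mul_eq_zero.mp _).resolve_left (mul_ne_zero (mul_ne_zero nU0 nU1') nU2')
      linear_combination x2
    · apply (mul_eq_zero.mp _).resolve_left (mul_ne_zero (mul_ne_zero nU0 nU1') nU2')
      linear_combination x1
  · subst u0 v1 v2
    have nV0 : V₀ ≠ 0 := by simpa using n0
    have nU1 : U₁ ≠ 0 := by simpa using n1
    have nU2 : U₂ ≠ 0 := by simpa using n2
    obtain rfl : U₀' = 0 := by simpa [nV0] using W0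
    have nV1' : V₁' ≠ 0 := by rintro rfl; simp at w1
    have nV2' : V₂' ≠ 0 := by rintro rfl; simp at w2
    have nU0'' : U₀'' ≠ 0 := by rintro rfl; simp at s0
    refine ⟨?_, ?_, ?_⟩
    · apply (mul_eq_zero.mp _).resolve_left (mul_ne_zero nU0'' (mul_ne_zero nU1 nU2))
      linear_combination x0
    · apply (mul_eq_zero.mp _).resolve_left (mul_ne_zero hc (mul_ne_zero (mul_ne_zero nV0 nV1') nV2'))
      linear_combination x2
    · apply (mul_eq_zero.mp _).resolve_left (mul_ne_zero hc (mul_ne_zero (mul_ne_zero nV0 nV1') nV2'))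
      linear_combination x1

/-- A hypersurface with an equation of the form `prodSum` has at most nodes as singularities. -/
theorem mem_sing_iff {τ : Fin 3 → ℍ} {X : Set (Torus τ)} (hu : ∀ j, AnalyticAt ℂ (u j) (z j))
    (hv : ∀ j, AnalyticAt ℂ (v j) (z j)) (hX : ∀ᶠ w in 𝓝 z, (proj τ w ∈ X ↔ prodSum u v c w = 0))
    (hc : c ≠ 0) (hne : ∀ j, u j (z j) ≠ 0 ∨ v j (z j) ≠ 0)
    (hW : ∀ j ≠ 0, u j (z j) = 0 ∨ v j (z j) = 0 → wr u v z j ≠ 0)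
    (hW' : ∀ j, wr u v z j = 0 → wr' u v z j ≠ 0) :
    (proj τ z ∈ Sing X ↔ proj τ z ∈ X ∧ IsCritical u v z) ∧
      (proj τ z ∈ Sing X → IsNode X (proj τ z)) := by
  have h := sing_prodSum hu hv hX fun hF hP =>
    hessian_nondegenerate hc hne hW hW' hF ((critical_iff hc hne hW hF).mp hP)
  refine ⟨?_, h.2⟩
  rw [h.1, hX.self_of_nhds]
  exact and_congr_right fun hF => critical_iff hc hne hW hF

end ProdSum

/-! ### The singular loci of the Burniat hypersurfaces -/

section Hypersurfaces

variable {τ : Fin 3 → ℍ}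

lemma exists_proj_eq (p : Torus τ) : ∃ z, proj τ z = p := by
  choose z hz using fun j => cls_surjective (p j)
  exact ⟨z, funext hz⟩

lemma LocalRep.ne_zero {τ : ℍ} {z : ℂ} {N D : ℂ → ℂ} (h : LocalRep τ z N D) :
    N z ≠ 0 ∨ D z ≠ 0 := by
  rw [h.num_eq, h.den_eq, or_iff_not_imp_left, not_not]
  exact legendreDen_ne_zero_of_num

lemma LocalRep.wronskian_ne_zero {τ : ℍ} {z : ℂ} {N D : ℂ → ℂ} (h : LocalRep τ z N D)
    (h0 : N z = 0 ∨ D z = 0) : deriv N z * D z - N z * deriv D z ≠ 0 := by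
  rw [ne_eq, h.wronskian]
  intro h2
  rw [h.num_eq, h.den_eq] at h0
  exact h0.elim (legendreNum_ne_zero_of_two_smul h2) (legendreDen_ne_zero_of_two_smul h2)

lemma eventually_scale {z : Fin 3 → ℂ} {N D : Fin 3 → ℂ → ℂ}
    (h : ∀ j, LocalRep (τ j) (z j) (N j) (D j)) :
    ∀ᶠ w : Fin 3 → ℂ in 𝓝 z, ∀ j, ∃ k : ℂ, k ≠ 0 ∧
      legendreNum (τ j) (proj τ w j) = k * N j (w j) ∧
      legendreDen (τ j) (proj τ w j) = k * D j (w j) :=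
  eventually_all.mpr fun j => (continuous_apply j).continuousAt.eventually (h j).scale

/-- Zeros and poles of a Legendre function are not branch points. This excludes the two mixed kinds
of critical zeros and leaves the points where all Wronskians vanish. -/
theorem mem_sing_Xmu_iff {μ : ℂ} (hμ : μ ≠ 0) (p : Torus τ) :
    (p ∈ Sing (Xmu τ μ) ↔ p ∈ Xmu τ μ ∧ ∀ j, 2 • p j = 0) ∧
      (p ∈ Sing (Xmu τ μ) → IsNode (Xmu τ μ) p) := by
  obtain ⟨z, rfl⟩ := exists_proj_eq p
  choose N D h using fun j => exists_localRep (τ := τ j) (z j)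
  have hX : ∀ᶠ w in 𝓝 z, (proj τ w ∈ Xmu τ μ ↔ prodSum N D (-μ) w = 0) := by
    filter_upwards [eventually_scale h] with w hw
    obtain ⟨k₀, hk₀, n₀, d₀⟩ := hw 0
    obtain ⟨k₁, hk₁, n₁, d₁⟩ := hw 1
    obtain ⟨k₂, hk₂, n₂, d₂⟩ := hw 2
    have hk : k₀ * k₁ * k₂ ≠ 0 := mul_ne_zero (mul_ne_zero hk₀ hk₁) hk₂
    rw [Xmu, Set.mem_ofPred_eq, n₀, n₁, n₂, d₀, d₁, d₂, ← sub_eq_zero, prodSum]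
    rw [← mul_eq_zero_iff_left hk (b := _ + _)]
    refine Eq.congr ?_ rfl
    ring
  have hmain := mem_sing_iff (fun j => (h j).num) (fun j => (h j).den) hX (neg_ne_zero.mpr hμ)
    (fun j => (h j).ne_zero) (fun j _ h0 => (h j).wronskian_ne_zero h0)
    (fun j h0 => (h j).second ((h j).wronskian.mp h0))
  refine ⟨?_, hmain.2⟩
  rw [hmain.1]
  refine and_congr_right fun _ => ⟨?_, fun h2 => Or.inl fun j => ⟨(h j).wronskian.mpr (h2 j), ?_, ?_⟩⟩
  · rintro (hc | ⟨hw, hv, -⟩ | ⟨hw, hu, -⟩)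
    · exact fun j => (h j).wronskian.mp (hc j).1
    · exact absurd hw ((h 0).wronskian_ne_zero (Or.inr hv))
    · exact absurd hw ((h 0).wronskian_ne_zero (Or.inl hu))
  · rw [(h j).num_eq]; exact legendreNum_ne_zero_of_two_smul (h2 j)
  · rw [(h j).den_eq]; exact legendreDen_ne_zero_of_two_smul (h2 j)

/-- The form `ν₁ N + ν₂ b₁ D`. -/
def formA (τ : ℍ) (ν₁ ν₂ : ℂ) (x : E τ) : ℂ := ν₁ * legendreNum τ x + ν₂ * b τ * legendreDen τ x

/-- The form `ν₂ N + ν₁ b₁ D`. -/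
def formB (τ : ℍ) (ν₁ ν₂ : ℂ) (x : E τ) : ℂ := ν₂ * legendreNum τ x + ν₁ * b τ * legendreDen τ x

lemma mem_Xnu_iff {ν₁ ν₂ : ℂ} {p : Torus τ} : p ∈ Xnu τ ν₁ ν₂ ↔
    formA (τ 0) ν₁ ν₂ (p 0) * legendreNum (τ 1) (p 1) * legendreNum (τ 2) (p 2) +
      b (τ 1) * b (τ 2) *
        (formB (τ 0) ν₁ ν₂ (p 0) * legendreDen (τ 1) (p 1) * legendreDen (τ 2) (p 2)) = 0 := by
  rw [Xnu, Set.mem_ofPred_eq, formA, formB]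
  refine Eq.congr ?_ rfl
  ring

lemma deriv_combination {f g : ℂ → ℂ} {z : ℂ} (hf : AnalyticAt ℂ f z) (hg : AnalyticAt ℂ g z)
    (s t : ℂ) : deriv (fun w => s * f w + t * g w) z = s * deriv f z + t * deriv g z :=
  ((hf.differentiableAt.hasDerivAt.const_mul s).add
    (hg.differentiableAt.hasDerivAt.const_mul t)).deriv

lemma deriv_deriv_combination {f g : ℂ → ℂ} {z : ℂ} (hf : AnalyticAt ℂ f z)
    (hg : AnalyticAt ℂ g z) (s t : ℂ) :
    deriv (deriv fun w => s * f w + t * g w) z = s * deriv (deriv f) z + t * deriv (deriv g) z := by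
  rw [← deriv_combination hf.deriv hg.deriv]
  refine EventuallyEq.deriv_eq ?_
  filter_upwards [hf.eventually_analyticAt, hg.eventually_analyticAt] with w h1 h2
  exact deriv_combination h1 h2 s t

/-- Passing from `(N, D)` to the pair `formA`, `formB` multiplies the first Wronskian by `b₁(ν₁² -
ν₂²) ≠ 0`, so its zeros are unchanged. The two mixed kinds of critical zeros are the two families in
`nodesNu`. -/
theorem mem_sing_Xnu_iff {ν₁ ν₂ : ℂ} (h₁ : ν₁ ≠ ν₂) (h₂ : ν₁ ≠ -ν₂) (p : Torus τ) :
    (p ∈ Sing (Xnu τ ν₁ ν₂) ↔ p ∈ Xnu τ ν₁ ν₂ ∧ ((∀ j, 2 • p j = 0) ∨ p ∈ nodesNu τ ν₁ ν₂)) ∧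
      (p ∈ Sing (Xnu τ ν₁ ν₂) → IsNode (Xnu τ ν₁ ν₂) p) := by
  obtain ⟨z, rfl⟩ := exists_proj_eq p
  choose N D h using fun j => exists_localRep (τ := τ j) (z j)
  set u : Fin 3 → ℂ → ℂ :=
    ![fun w => ν₁ * N 0 w + ν₂ * b (τ 0) * D 0 w, N 1, N 2] with hu
  set v : Fin 3 → ℂ → ℂ :=
    ![fun w => ν₂ * N 0 w + ν₁ * b (τ 0) * D 0 w, D 1, D 2] with hv
  have hdet : b (τ 0) * (ν₁ ^ 2 - ν₂ ^ 2) ≠ 0 := by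
    refine mul_ne_zero b_ne_zero ?_
    rw [sq_sub_sq]
    exact mul_ne_zero (fun h => h₂ (eq_neg_of_add_eq_zero_left h)) (sub_ne_zero.mpr h₁)
  have hX : ∀ᶠ w in 𝓝 z, (proj τ w ∈ Xnu τ ν₁ ν₂ ↔ prodSum u v (b (τ 1) * b (τ 2)) w = 0) := by
    filter_upwards [eventually_scale h] with w hw
    obtain ⟨k₀, hk₀, n₀, d₀⟩ := hw 0
    obtain ⟨k₁, hk₁, n₁, d₁⟩ := hw 1
    obtain ⟨k₂, hk₂, n₂, d₂⟩ := hw 2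
    have hk : k₀ * k₁ * k₂ ≠ 0 := mul_ne_zero (mul_ne_zero hk₀ hk₁) hk₂
    rw [mem_Xnu_iff, formA, formB, n₀, n₁, n₂, d₀, d₁, d₂, prodSum]
    rw [← mul_eq_zero_iff_left hk (b := u 0 _ * _ * _ + _)]
    refine Eq.congr ?_ rfl
    simp only [hu, hv, Matrix.cons_val]
    ring
  have hua : ∀ j, AnalyticAt ℂ (u j) (z j) := by
    intro j
    fin_cases j
    · exact (analyticAt_const.fun_mul (h 0).num).fun_add (analyticAt_const.fun_mul (h 0).den)
    · exact (h 1).num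
    · exact (h 2).num
  have hva : ∀ j, AnalyticAt ℂ (v j) (z j) := by
    intro j
    fin_cases j
    · exact (analyticAt_const.fun_mul (h 0).num).fun_add (analyticAt_const.fun_mul (h 0).den)
    · exact (h 1).den
    · exact (h 2).den
  have hw0 : wr u v z 0 = b (τ 0) * (ν₁ ^ 2 - ν₂ ^ 2) *
      (deriv (N 0) (z 0) * D 0 (z 0) - N 0 (z 0) * deriv (D 0) (z 0)) := by
    simp only [wr, hu, hv, Matrix.cons_val, deriv_combination (h 0).num (h 0).den]
    ring
  have hw0' : wr' u v z 0 = b (τ 0) * (ν₁ ^ 2 - ν₂ ^ 2) *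
      (deriv (deriv (N 0)) (z 0) * D 0 (z 0) - N 0 (z 0) * deriv (deriv (D 0)) (z 0)) := by
    simp only [wr', hu, hv, Matrix.cons_val, deriv_deriv_combination (h 0).num (h 0).den]
    ring
  have hwr0 : wr u v z 0 = 0 ↔ 2 • proj τ z 0 = 0 := by
    rw [hw0, mul_eq_zero_iff_left hdet]; exact (h 0).wronskian
  have hmain := mem_sing_iff hua hva hX (mul_ne_zero b_ne_zero b_ne_zero)
    (fun j => by
      fin_cases j
      · by_contra! hcon
        simp only [hu, hv, Fin.zero_eta, Matrix.cons_val] at hcon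
        obtain ⟨e1, e2⟩ := hcon
        have d0 : D 0 (z 0) = 0 := by
          refine (mul_eq_zero.mp ?_).resolve_left hdet
          linear_combination ν₁ * e2 - ν₂ * e1
        have n0 : N 0 (z 0) = 0 := by
          refine (mul_eq_zero.mp ?_).resolve_left hdet
          linear_combination b (τ 0) * ν₁ * e1 - b (τ 0) * ν₂ * e2
        exact (h 0).ne_zero.elim (fun h => h n0) (fun h => h d0)
      · exact (h 1).ne_zero
      · exact (h 2).ne_zero)
    (fun j hj => by
      fin_cases j
      · exact absurd rfl hj
      · exact (h 1).wronskian_ne_zero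
      · exact (h 2).wronskian_ne_zero)
    (fun j => by
      fin_cases j
      · intro h0
        show wr' u v z 0 ≠ 0
        rw [hw0']
        exact mul_ne_zero hdet ((h 0).second (hwr0.mp h0))
      · exact fun h0 => (h 1).second ((h 1).wronskian.mp h0)
      · exact fun h0 => (h 2).second ((h 2).wronskian.mp h0))
  refine ⟨?_, hmain.2⟩
  rw [hmain.1]
  refine and_congr_right fun hmem => ?_
  have hu0 : u 0 (z 0) = formA (τ 0) ν₁ ν₂ (proj τ z 0) := by
    simp only [hu, Matrix.cons_val, formA, (h 0).num_eq, (h 0).den_eq]; rfl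
  have hv0 : v 0 (z 0) = formB (τ 0) ν₁ ν₂ (proj τ z 0) := by
    simp only [hv, Matrix.cons_val, formB, (h 0).num_eq, (h 0).den_eq]; rfl
  have hA : 2 • proj τ z 0 = 0 → (formA (τ 0) ν₁ ν₂ (proj τ z 0) = 0 ↔
      ν₂ * b (τ 0) + ν₁ * legendre (τ 0) (proj τ z 0) = 0) := fun h2 => by
    have hd := legendreDen_ne_zero_of_two_smul h2
    have e : formA (τ 0) ν₁ ν₂ (proj τ z 0) = legendreDen (τ 0) (proj τ z 0) *
        (ν₂ * b (τ 0) + ν₁ * legendre (τ 0) (proj τ z 0)) := by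
      rw [legendre, formA]
      field_simp
      ring
    rw [e, mul_eq_zero_iff_left hd]
  have hB : 2 • proj τ z 0 = 0 → (formB (τ 0) ν₁ ν₂ (proj τ z 0) = 0 ↔
      ν₁ * b (τ 0) + ν₂ * legendre (τ 0) (proj τ z 0) = 0) := fun h2 => by
    have hd := legendreDen_ne_zero_of_two_smul h2
    have e : formB (τ 0) ν₁ ν₂ (proj τ z 0) = legendreDen (τ 0) (proj τ z 0) *
        (ν₁ * b (τ 0) + ν₂ * legendre (τ 0) (proj τ z 0)) := by
      rw [legendre, formB]
      field_simp
      ring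
    rw [e, mul_eq_zero_iff_left hd]
  have hu1 : u 1 (z 1) = legendreNum (τ 1) (proj τ z 1) := (h 1).num_eq
  have hu2 : u 2 (z 2) = legendreNum (τ 2) (proj τ z 2) := (h 2).num_eq
  have hv1 : v 1 (z 1) = legendreDen (τ 1) (proj τ z 1) := (h 1).den_eq
  have hv2 : v 2 (z 2) = legendreDen (τ 2) (proj τ z 2) := (h 2).den_eq
  rw [IsCritical, hwr0, hu0, hv0, hu1, hu2, hv1, hv2, legendreNum_eq_zero_iff,
    legendreNum_eq_zero_iff, legendreDen_eq_zero_iff, legendreDen_eq_zero_iff]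
  refine or_congr ⟨fun hc => ?_, fun h2 => ?_⟩ (or_congr ?_ ?_)
  · rw [Fin.forall_fin_succ, Fin.forall_fin_succ, Fin.forall_fin_succ]
    exact ⟨hwr0.mp (hc 0).1, (h 1).wronskian.mp (hc 1).1, (h 2).wronskian.mp (hc 2).1, nofun⟩
  · rw [mem_Xnu_iff] at hmem
    have n1 := legendreNum_ne_zero_of_two_smul (h2 1)
    have n2 := legendreNum_ne_zero_of_two_smul (h2 2)
    have d1 := legendreDen_ne_zero_of_two_smul (h2 1)
    have d2 := legendreDen_ne_zero_of_two_smul (h2 2)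
    -- The remaining factors are nonzero at two-torsion points, so by the equation the two forms
    -- could only vanish together, which their independence forbids.
    have hAB : ¬(formA (τ 0) ν₁ ν₂ (proj τ z 0) = 0 ∧ formB (τ 0) ν₁ ν₂ (proj τ z 0) = 0) := by
      rintro ⟨e1, e2⟩
      refine legendreDen_ne_zero_of_two_smul (h2 0) ((mul_eq_zero.mp ?_).resolve_left hdet)
      rw [formA] at e1
      rw [formB] at e2
      linear_combination ν₁ * e2 - ν₂ * e1
    have bb : b (τ 1) * b (τ 2) ≠ 0 := mul_ne_zero b_ne_zero b_ne_zero
    intro j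
    fin_cases j
    · refine ⟨hwr0.mpr (h2 0), fun e => ?_, fun e => ?_⟩
      · replace e := hu0.symm.trans e
        rw [e] at hmem
        refine hAB ⟨e, ?_⟩
        simpa [bb, b_ne_zero, d1, d2] using hmem
      · replace e := hv0.symm.trans e
        rw [e] at hmem
        refine hAB ⟨?_, e⟩
        simpa [n1, n2] using hmem
    · exact ⟨(h 1).wronskian.mpr (h2 1), fun e => n1 (hu1.symm.trans e), fun e => d1 (hv1.symm.trans e)⟩
    · exact ⟨(h 2).wronskian.mpr (h2 2), fun e => n2 (hu2.symm.trans e), fun e => d2 (hv2.symm.trans e)⟩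
  · constructor
    · rintro ⟨q1, q2, q3, q4⟩
      exact ⟨q3, q4, q1, (hB q1).mp q2⟩
    · rintro ⟨q3, q4, q1, q2⟩
      exact ⟨q1, (hB q1).mpr q2, q3, q4⟩
  · constructor
    · rintro ⟨q1, q2, q3, q4⟩
      exact ⟨q3, q4, q1, (hA q1).mp q2⟩
    · rintro ⟨q3, q4, q1, q2⟩
      exact ⟨q1, (hA q1).mpr q2, q3, q4⟩

lemma nodesNu_subset_Xnu {ν₁ ν₂ : ℂ} : nodesNu τ ν₁ ν₂ ⊆ Xnu τ ν₁ ν₂ := by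
  rintro p (⟨q1, q2, q3, q4⟩ | ⟨q1, q2, q3, q4⟩)
  · rw [← legendreNum_eq_zero_iff] at q1 q2
    have hd := legendreDen_ne_zero_of_two_smul q3
    have hB : formB (τ 0) ν₁ ν₂ (p 0) = 0 := by
      rw [legendre] at q4
      field_simp at q4
      rw [formB]
      linear_combination q4
    rw [mem_Xnu_iff, q1, q2, hB]
    ring
  · rw [← legendreDen_eq_zero_iff] at q1 q2
    have hd := legendreDen_ne_zero_of_two_smul q3
    have hA : formA (τ 0) ν₁ ν₂ (p 0) = 0 := by
      rw [legendre] at q4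
      field_simp at q4
      rw [formA]
      linear_combination q4
    rw [mem_Xnu_iff, q1, q2, hA]
    ring

/-- The involution `-1` of the torus, as an element of the group. -/
def minusOne : Grp := ![![1, 0, 0], ![1, 0, 0], ![1, 0, 0]]

lemma act_minusOne {p : Torus τ} (h : ∀ j, 2 • p j = 0) : act minusOne p = p := by
  funext j
  have hj := neg_eq_self_of_two_smul (h j)
  fin_cases j <;> simpa [act, minusOne, ZMod.val_one] using hj

lemma ActsFreelyOn.not_two_torsion {G : AddSubgroup Grp} {X : Set (Torus τ)}
    (hfree : ActsFreelyOn G X) (hG : minusOne ∈ G) {p : Torus τ} (hp : p ∈ X) :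
    ¬ ∀ j, 2 • p j = 0 := fun h =>
  hfree minusOne hG (by decide) p hp (act_minusOne h)

lemma minusOne_mem_G₁ : minusOne ∈ G₁ := AddSubgroup.subset_closure (by simp [minusOne])

lemma minusOne_mem_G₂ : minusOne ∈ G₂ := by
  have h : minusOne = ![![1, 0, 0], ![0, 0, 1], ![1, 0, 1]] + ![![0, 0, 0], ![1, 0, 1], ![0, 0, 1]] := by
    decide
  rw [h]
  exact add_mem (AddSubgroup.subset_closure (by simp)) (AddSubgroup.subset_closure (by simp))

end Hypersurfaces

/-! ### Counting the nodes -/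

section Counting

/-- The two-torsion points of `E τ`. -/
def tors (τ : ℍ) (i k : Bool) : E τ :=
  (if i then cls τ (1 / 2) else 0) + (if k then cls τ (τ / 2) else 0)

/-- The sign `-1` or `1`. -/
def sgn (i : Bool) : ℂ := if i then -1 else 1

lemma two_smul_eq_zero_iff_tors {τ : ℍ} {x : E τ} : 2 • x = 0 ↔ ∃ i k, x = tors τ i k := by
  rw [two_smul_eq_zero_iff]
  simp only [tors, Bool.exists_bool]
  simp
  tauto

lemma two_smul_tors {τ : ℍ} (i k : Bool) : 2 • tors τ i k = 0 :=
  two_smul_eq_zero_iff_tors.mpr ⟨i, k, rfl⟩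

lemma legendre_tors {τ : ℍ} (i k : Bool) :
    legendre τ (tors τ i k) = sgn i * if k then a τ else 1 := by
  cases i <;> cases k <;> simp [tors, sgn, legendre_zero, legendre_half, legendre_half_tau,
    legendre_half_add_half_tau, -one_div]

/-- On two-torsion points, translation by `1/2` negates the Legendre function and translation by
`τ/2` turns it into `a / 𝓛`. Both node counts rest on these symmetries. -/
lemma legendre_tors_xor {τ : ℍ} (i k i' k' : Bool) :
    legendre τ (tors τ (i ^^ i') (k ^^ k')) =
      sgn i' * if k' then a τ / legendre τ (tors τ i k) else legendre τ (tors τ i k) := by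
  have := a_ne_zero (τ := τ)
  simp only [legendre_tors]
  cases i <;> cases k <;> cases i' <;> cases k' <;> simp [sgn, this, div_neg]

lemma legendre_tors_ne_zero {τ : ℍ} (i k : Bool) : legendre τ (tors τ i k) ≠ 0 := by
  have := a_ne_zero (τ := τ)
  rw [legendre_tors]
  cases i <;> cases k <;> simp [sgn, this]

lemma neg_ne_self_complex {x : ℂ} (h : x ≠ 0) : -x ≠ x := fun e => h (CharZero.neg_eq_self_iff.mp e)

lemma legendre_tors_injective {τ : ℍ} {i k i' k' : Bool}
    (h : legendre τ (tors τ i k) = legendre τ (tors τ i' k')) : i = i' ∧ k = k' := by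
  have h0 := a_ne_zero (τ := τ)
  have h1 := a_ne_one (τ := τ)
  have h2 := a_ne_neg_one (τ := τ)
  have h3 := neg_ne_self_complex h0
  have h4 : (-1 : ℂ) ≠ 1 := neg_ne_self_complex one_ne_zero
  have h5 : -a τ ≠ 1 := fun h => h2 (by rw [← h, neg_neg])
  simp only [legendre_tors] at h
  cases i <;> cases k <;> cases i' <;> cases k' <;>
    simp [sgn, h1, h2, h3, h4, h5, h1.symm, h2.symm, h3.symm, h4.symm, h5.symm] at h ⊢

lemma tors_injective {τ : ℍ} {i k i' k' : Bool} (h : tors τ i k = tors τ i' k') :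
    i = i' ∧ k = k' :=
  legendre_tors_injective (by rw [h])

/-- The point of the torus with given coordinates. -/
def triple {τ : Fin 3 → ℍ} (x : E (τ 0)) (y : E (τ 1)) (w : E (τ 2)) : Torus τ := fun j =>
  match j with
  | 0 => x
  | 1 => y
  | 2 => w

variable {τ : Fin 3 → ℍ}

lemma triple_eta (p : Torus τ) : p = triple (p 0) (p 1) (p 2) := by
  funext j; fin_cases j <;> rfl

lemma ncard_range_bool {α : Type*} {f : Bool × Bool × Bool → α} (hf : Function.Injective f) :
    (Set.range f).ncard = 8 := by
  rw [← Set.image_univ, Set.ncard_image_of_injective _ hf, Set.ncard_univ]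
  simp

/-! #### The family with parameter `ν` -/

/-- Multiply by `b / 𝓛` and use `b² = a`: translation by `τ/2` exchanges the equations of the two
families of nodes. -/
lemma nu_relation_add_half_tau {ν₁ ν₂ : ℂ} {τ : ℍ} (i k : Bool)
    (h : ν₁ * b τ + ν₂ * legendre τ (tors τ i k) = 0) :
    ν₂ * b τ + ν₁ * legendre τ (tors τ i !k) = 0 := by
  have hb := b_ne_zero (τ := τ)
  rw [legendre_tors, ← b_sq] at *
  cases i <;> cases k <;> simp [sgn] at h ⊢
  · linear_combination b τ * h
  · apply mul_left_cancel₀ hb; linear_combination h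
  · linear_combination (-b τ) * h
  · apply mul_left_cancel₀ hb; linear_combination -h

lemma nodesNu_nonempty_iff {ν₁ ν₂ : ℂ} : (nodesNu τ ν₁ ν₂).Nonempty ↔
    ∃ i k, ν₁ * b (τ 0) + ν₂ * legendre (τ 0) (tors (τ 0) i k) = 0 := by
  constructor
  · rintro ⟨p, ⟨-, -, h2, h⟩ | ⟨-, -, h2, h⟩⟩
    · obtain ⟨i, k, hik⟩ := two_smul_eq_zero_iff_tors.mp h2
      exact ⟨i, k, hik ▸ h⟩
    · obtain ⟨i, k, hik⟩ := two_smul_eq_zero_iff_tors.mp h2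
      rw [hik] at h
      exact ⟨i, !k, nu_relation_add_half_tau i k h⟩
  · rintro ⟨i, k, h⟩
    exact ⟨triple (tors (τ 0) i k) (cls (τ 1) (1 / 4)) (cls (τ 2) (1 / 4)),
      Or.inl ⟨Or.inl rfl, Or.inl rfl, two_smul_tors i k, h⟩⟩

lemma mk_eq_mk_iff_cross {x y x' y' : ℂ} (h : ![x, y] ≠ 0) (h' : ![x', y'] ≠ 0) :
    Projectivization.mk ℂ ![x, y] h = Projectivization.mk ℂ ![x', y'] h' ↔ x * y' = y * x' := by
  rw [Projectivization.mk_eq_mk_iff']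
  constructor
  · rintro ⟨c, hc⟩
    have h0 := congrFun hc 0
    have h1 := congrFun hc 1
    simp only [Pi.smul_apply, Matrix.cons_val, smul_eq_mul] at h0 h1
    rw [← h0, ← h1]; ring
  · intro e
    by_cases hx : x' = 0
    · have hy : y' ≠ 0 := by rintro rfl; exact h' (by simp [hx])
      refine ⟨y / y', ?_⟩
      have : x = 0 := by
        rw [hx, mul_zero] at e
        exact (mul_eq_zero.mp e).resolve_right hy
      ext j; fin_cases j <;> simp [hx, this, hy]
    · refine ⟨x / x', ?_⟩
      ext j; fin_cases j
      · simp [hx]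
      · simp only [Fin.mk_one, Pi.smul_apply, Matrix.cons_val, smul_eq_mul]
        field_simp
        linear_combination e

/-- The points `(± b : 1)` correspond to the values `𝓛 = ∓ a`, and `(1 : ± b)` to `𝓛 = ∓ 1`. -/
lemma mem_specialNu_iff {ν₁ ν₂ : ℂ} {τ : ℍ} (h₀ : ![ν₁, ν₂] ≠ 0) :
    Projectivization.mk ℂ ![ν₁, ν₂] h₀ ∈ specialNu (b τ) ↔
      ∃ i k, ν₁ * b τ + ν₂ * legendre τ (tors τ i k) = 0 := by
  have hb := b_ne_zero (τ := τ)
  have e1 : ν₁ * 1 = ν₂ * b τ ↔ ν₁ * b τ + ν₂ * (-b τ ^ 2) = 0 := by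
    constructor <;> intro h
    · linear_combination b τ * h
    · apply mul_left_cancel₀ hb; linear_combination h
  have e2 : ν₁ * 1 = ν₂ * (-b τ) ↔ ν₁ * b τ + ν₂ * b τ ^ 2 = 0 := by
    constructor <;> intro h
    · linear_combination b τ * h
    · apply mul_left_cancel₀ hb; linear_combination h
  have e3 : ν₁ * b τ = ν₂ * 1 ↔ ν₁ * b τ + ν₂ * (-1) = 0 := by
    constructor <;> intro h <;> linear_combination h
  have e4 : ν₁ * (-b τ) = ν₂ * 1 ↔ ν₁ * b τ + ν₂ * 1 = 0 := by
    constructor <;> intro h <;> linear_combination -h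
  simp only [specialNu, Set.mem_insert_iff, Set.mem_singleton_iff, mk_eq_mk_iff_cross, e1, e2, e3,
    e4, legendre_tors, Bool.exists_bool, sgn, ← b_sq]
  simp
  tauto

/-- The points `1/4`, `-1/4`, `τ/2 + 1/4`, `τ/2 - 1/4`. -/
def quarter (τ : ℍ) (i s : Bool) : E τ :=
  if i then (if s then cls τ (τ / 2 + 1 / 4) else cls τ (τ / 2 - 1 / 4))
  else (if s then cls τ (1 / 4) else cls τ (-(1 / 4)))

lemma quarter_injective {τ : ℍ} {i s i' s' : Bool} (h : quarter τ i s = quarter τ i' s') :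
    i = i' ∧ s = s' := by
  have key : ∀ i s, ∃ x : ℂ, quarter τ i s = cls τ x ∧
      x = ((if s then 1 else -1 : ℤ) : ℂ) / 4 + ((if i then 2 else 0 : ℤ) : ℂ) / 4 * τ := by
    intro i s
    cases i <;> cases s
    · exact ⟨_, rfl, by push_cast; simp; ring⟩
    · exact ⟨_, rfl, by push_cast; simp⟩
    · exact ⟨_, rfl, by push_cast; simp; ring⟩
    · exact ⟨_, rfl, by push_cast; simp; ring⟩
  obtain ⟨x, hx, hx'⟩ := key i s
  obtain ⟨y, hy, hy'⟩ := key i' s'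
  rw [hx, hy, cls_quarter_eq_iff _ _ _ _ hx' hy'] at h
  revert h
  cases i <;> cases s <;> cases i' <;> cases s' <;> decide

/-- Both `ν₁` and `ν₂` are nonzero, and `𝓛` separates two-torsion points, so the first coordinate is
determined within each family. Each family contributes four choices of signs. -/
theorem ncard_nodesNu {ν₁ ν₂ : ℂ} (h₀ : ![ν₁, ν₂] ≠ 0) (hne : (nodesNu τ ν₁ ν₂).Nonempty) :
    (nodesNu τ ν₁ ν₂).ncard = 8 := by
  obtain ⟨i, k, h⟩ := nodesNu_nonempty_iff.mp hne
  have h' := nu_relation_add_half_tau i k h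
  have hν₂ : ν₂ ≠ 0 := by
    rintro rfl
    have : ν₁ = 0 := by simpa [b_ne_zero] using h
    exact h₀ (by simp [this])
  have hν₁ : ν₁ ≠ 0 := by
    rintro rfl
    have : ν₂ = 0 := by simpa [b_ne_zero] using h'
    exact h₀ (by simp [this])
  let f : Bool × Bool × Bool → Torus τ := fun x =>
    triple (tors (τ 0) i (k ^^ x.1)) (quarter (τ 1) x.1 x.2.1) (quarter (τ 2) x.1 x.2.2)
  have hf : Function.Injective f := by
    rintro ⟨x, y, w⟩ ⟨x', y', w'⟩ h
    have e1 := quarter_injective (congrFun h 1)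
    have e2 := quarter_injective (congrFun h 2)
    simp only [Prod.mk.injEq]
    exact ⟨e1.1, e1.2, e2.2⟩
  have hq : ∀ {τ : ℍ} {x : E τ}, (x = cls τ (1 / 4) ∨ x = cls τ (-(1 / 4))) ↔
      ∃ s, x = quarter τ false s := by
    intro τ x; simp [quarter, or_comm]
  have hq' : ∀ {τ : ℍ} {x : E τ}, (x = cls τ (τ / 2 + 1 / 4) ∨ x = cls τ (τ / 2 - 1 / 4)) ↔
      ∃ s, x = quarter τ true s := by
    intro τ x; simp [quarter, or_comm]
  rw [show nodesNu τ ν₁ ν₂ = Set.range f from ?_, ncard_range_bool hf]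
  ext p
  simp only [nodesNu, Set.mem_union, Set.mem_ofPred_eq, hq, hq', two_smul_eq_zero_iff_tors]
  constructor
  · rintro (⟨⟨s, hs⟩, ⟨t, ht⟩, ⟨i', k', hik⟩, e⟩ | ⟨⟨s, hs⟩, ⟨t, ht⟩, ⟨i', k', hik⟩, e⟩)
    · refine ⟨(false, s, t), ?_⟩
      rw [hik] at e
      obtain ⟨rfl, rfl⟩ := legendre_tors_injective (mul_left_cancel₀ hν₂ (add_left_cancel (e.trans h.symm)))
      rw [triple_eta p, hs, ht, hik]
      simp [f]
    · refine ⟨(true, s, t), ?_⟩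
      rw [hik] at e
      obtain ⟨rfl, rfl⟩ := legendre_tors_injective (mul_left_cancel₀ hν₁ (add_left_cancel (e.trans h'.symm)))
      rw [triple_eta p, hs, ht, hik]
      simp [f]
  · rintro ⟨⟨x, s, t⟩, rfl⟩
    cases x
    · exact Or.inl ⟨⟨s, rfl⟩, ⟨t, rfl⟩, ⟨i, k ^^ false, rfl⟩, by simpa [f, triple] using h⟩
    · exact Or.inr ⟨⟨s, rfl⟩, ⟨t, rfl⟩, ⟨i, k ^^ true, rfl⟩, by simpa [f, triple] using h'⟩

/-! #### The hypersurface `𝓛₁𝓛₂𝓛₃ = b₁b₂b₃` -/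

lemma mem_Xmu_iff_of_two_smul {μ : ℂ} {p : Torus τ} (h : ∀ j, 2 • p j = 0) : p ∈ Xmu τ μ ↔
    legendre (τ 0) (p 0) * legendre (τ 1) (p 1) * legendre (τ 2) (p 2) = μ := by
  have d := fun j => legendreDen_ne_zero_of_two_smul (h j)
  have d0 := d 0
  have d1 := d 1
  have d2 := d 2
  simp only [Xmu, Set.mem_ofPred_eq, legendre]
  rw [div_mul_div_comm, div_mul_div_comm, div_eq_iff (by simp [d0, d1, d2])]

lemma b_prod_ne_zero : b (τ 0) * b (τ 1) * b (τ 2) ≠ 0 :=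
  mul_ne_zero (mul_ne_zero b_ne_zero b_ne_zero) b_ne_zero

lemma sing_Xb : Sing (Xb τ) = {p | p ∈ Xb τ ∧ ∀ j, 2 • p j = 0} :=
  Set.ext fun p => (mem_sing_Xmu_iff b_prod_ne_zero p).1

lemma sing_Xb_eq : Sing (Xb τ) = {p | ∃ s k : Fin 3 → Bool, p = (fun j => tors (τ j) (s j) (k j)) ∧
    legendre (τ 0) (tors (τ 0) (s 0) (k 0)) * legendre (τ 1) (tors (τ 1) (s 1) (k 1)) *
      legendre (τ 2) (tors (τ 2) (s 2) (k 2)) = b (τ 0) * b (τ 1) * b (τ 2)} := by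
  rw [sing_Xb]
  ext p
  constructor
  · rintro ⟨h, h2⟩
    rw [Xb, mem_Xmu_iff_of_two_smul h2] at h
    choose s k hsk using fun j => two_smul_eq_zero_iff_tors.mp (h2 j)
    refine ⟨s, k, funext hsk, ?_⟩
    rw [← hsk, ← hsk, ← hsk, h]
  · rintro ⟨s, k, rfl, h⟩
    have h2 : ∀ j, 2 • tors (τ j) (s j) (k j) = 0 := fun j => two_smul_tors _ _
    exact ⟨(mem_Xmu_iff_of_two_smul h2).mpr h, h2⟩

/-- The factors at a two-torsion point are `±1` or `± a_j`, so their products run through the signed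
subproducts of `a₁a₂a₃`. Conversely the whole sign can be put on the first factor. -/
lemma sing_Xb_nonempty_iff : (Sing (Xb τ)).Nonempty ↔
    b (τ 0) * b (τ 1) * b (τ 2) ∈ specialB τ := by
  have h1 : (Sing (Xb τ)).Nonempty ↔ ∃ s k : Fin 3 → Bool,
      legendre (τ 0) (tors (τ 0) (s 0) (k 0)) * legendre (τ 1) (tors (τ 1) (s 1) (k 1)) *
      legendre (τ 2) (tors (τ 2) (s 2) (k 2)) = b (τ 0) * b (τ 1) * b (τ 2) := by
    rw [sing_Xb_eq]
    constructor
    · rintro ⟨p, s, k, -, h⟩; exact ⟨s, k, h⟩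
    · rintro ⟨s, k, h⟩; exact ⟨_, s, k, rfl, h⟩
  rw [h1]
  simp only [legendre_tors, specialB, Set.mem_ofPred_eq]
  generalize b (τ 0) * b (τ 1) * b (τ 2) = β
  constructor
  · rintro ⟨s, k, rfl⟩
    refine ⟨sgn (s 0) * sgn (s 1) * sgn (s 2), ?_, ?_⟩
    · cases s 0 <;> cases s 1 <;> cases s 2 <;> simp [sgn]
    · generalize sgn (s 0) = x
      generalize sgn (s 1) = y
      generalize sgn (s 2) = w
      rcases k 0 <;> rcases k 1 <;> rcases k 2
      · left; simp
      · right; left; exact ⟨2, by simp; ring⟩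
      · right; left; exact ⟨1, by simp; ring⟩
      · right; right; left; exact ⟨1, 2, by decide, by simp; ring⟩
      · right; left; exact ⟨0, by simp; ring⟩
      · right; right; left; exact ⟨0, 2, by decide, by simp; ring⟩
      · right; right; left; exact ⟨0, 1, by decide, by simp; ring⟩
      · right; right; right; simp; ring
  · have key : ∀ t : ℂ, (t = 1 ∨ t = -1) → ∀ k : Fin 3 → Bool,
        β = t * ((if k 0 then a (τ 0) else 1) * (if k 1 then a (τ 1) else 1) *
          (if k 2 then a (τ 2) else 1)) → ∃ s k : Fin 3 → Bool,
        (sgn (s 0) * if k 0 then a (τ 0) else 1) * (sgn (s 1) * if k 1 then a (τ 1) else 1) *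
        (sgn (s 2) * if k 2 then a (τ 2) else 1) = β := by
      rintro t (rfl | rfl) k rfl
      · exact ⟨fun _ => false, k, by simp [sgn]⟩
      · exact ⟨![true, false, false], k, by simp [sgn]⟩
    rintro ⟨t, ht, h | ⟨i, h⟩ | ⟨i, j, hij, h⟩ | h⟩
    · exact key t ht (fun _ => false) (by simp [h])
    · refine key t ht (fun l => l = i) ?_
      rw [h]; fin_cases i <;> simp
    · refine key t ht (fun l => l = i ∨ l = j) ?_
      rw [h]; fin_cases i <;> fin_cases j <;> first | exact absurd rfl hij | (simp; done) | (simp; left; ring)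
    · exact key t ht (fun _ => true) (by simp [h])

lemma sgn_cases (i : Bool) : sgn i = 1 ∨ sgn i = -1 := by cases i <;> simp [sgn]

lemma sgn_prod_eq_one {i j l : Bool} (h : sgn i * sgn j * sgn l = 1) : j = (i ^^ l) := by
  revert h
  have : (-1 : ℂ) ≠ 1 := neg_ne_self_complex one_ne_zero
  cases i <;> cases j <;> cases l <;> simp [sgn, this]

lemma sgn_prod_xor (i l : Bool) : sgn i * sgn (i ^^ l) * sgn l = 1 := by
  cases i <;> cases l <;> simp [sgn]

/-- The ratio `a / 𝓛²` at a two-torsion point is `a` or its inverse. -/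
lemma ratio_ne {τ : ℍ} (i k : Bool) {ε : ℂ} (hε : ε = 1 ∨ ε = -1) :
    a τ / legendre τ (tors τ i k) ^ 2 ≠ ε := by
  have h0 := a_ne_zero (τ := τ)
  have h1 := a_ne_one (τ := τ)
  have h2 := a_ne_neg_one (τ := τ)
  have e : a τ / legendre τ (tors τ i k) ^ 2 = a τ ∨
      a τ / legendre τ (tors τ i k) ^ 2 = (a τ)⁻¹ := by
    rw [legendre_tors]
    cases i <;> cases k <;> simp [sgn] <;> field_simp <;> simp
  rcases e with e | e <;> rw [e] <;> rcases hε with rfl | rfl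
  · exact h1
  · exact h2
  · simpa using h1
  · intro h
    exact h2 (by rw [← inv_inv (a τ), h]; norm_num)

/-- Relative to one singular point with values `x_j`, every two-torsion point multiplies `x_j` by a
sign and possibly by `R_j = a_j / x_j²`. Here `R₀R₁R₂ = 1` because `b² = a`. The other singular
points are those whose multipliers have product `1`. -/
theorem ncard_sing_Xb (hne : (Sing (Xb τ)).Nonempty) : (Sing (Xb τ)).ncard = 8 := by
  rw [sing_Xb_eq] at hne ⊢
  obtain ⟨-, s, k, -, h⟩ := hne
  set x : Fin 3 → ℂ := fun j => legendre (τ j) (tors (τ j) (s j) (k j)) with hx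
  have hx0 : ∀ j, x j ≠ 0 := fun j => legendre_tors_ne_zero _ _
  have hxb : x 0 * x 1 * x 2 = b (τ 0) * b (τ 1) * b (τ 2) := h
  set R : Fin 3 → ℂ := fun j => a (τ j) / x j ^ 2 with hR
  have hRx : ∀ j, a (τ j) / x j = x j * R j := fun j => by
    have := hx0 j
    simp only [hR]; field_simp
  have hR1 : ∀ j (ε : ℂ), (ε = 1 ∨ ε = -1) → R j ≠ ε := fun j ε hε => ratio_ne _ _ hε
  have hRprod : R 0 * R 1 * R 2 = 1 := by
    simp only [hR]
    rw [div_mul_div_comm, div_mul_div_comm, ← mul_pow, ← mul_pow, hxb, ← b_sq, ← b_sq, ← b_sq,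
      ← mul_pow, ← mul_pow, div_self (pow_ne_zero 2 b_prod_ne_zero)]
  have hL : ∀ (j : Fin 3) i' k', legendre (τ j) (tors (τ j) (s j ^^ i') (k j ^^ k')) =
      x j * (sgn i' * if k' then R j else 1) := by
    intro j i' k'
    rw [legendre_tors_xor]
    cases k'
    · simp [hx, mul_comm]
    · rw [if_pos rfl, if_pos rfl, show a (τ j) / legendre (τ j) (tors (τ j) (s j) (k j)) = x j * R j
        from hRx j]
      ring
  -- Signs `y, y + y', y'` run through the four triples with product `1`; the last Boolean shifts
  -- all three coordinates by `τ/2` or none.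
  let f : Bool × Bool × Bool → Torus τ := fun y =>
    triple (tors (τ 0) (s 0 ^^ y.1) (k 0 ^^ y.2.2)) (tors (τ 1) (s 1 ^^ (y.1 ^^ y.2.1)) (k 1 ^^ y.2.2))
      (tors (τ 2) (s 2 ^^ y.2.1) (k 2 ^^ y.2.2))
  have hf : Function.Injective f := by
    rintro ⟨y, y', y''⟩ ⟨w, w', w''⟩ h
    have e0 := tors_injective (congrFun h 0)
    have e2 := tors_injective (congrFun h 2)
    simp only [Bool.xor_right_inj] at e0 e2
    simp only [Prod.mk.injEq]
    exact ⟨e0.1, e2.1, e0.2⟩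
  rw [← ncard_range_bool hf]
  congr 1
  ext p
  constructor
  · rintro ⟨s', k', rfl, hp⟩
    obtain ⟨i, hi⟩ : ∃ i : Fin 3 → Bool, ∀ j, s' j = (s j ^^ i j) :=
      ⟨fun j => s j ^^ s' j, fun j => by simp⟩
    obtain ⟨l, hl⟩ : ∃ l : Fin 3 → Bool, ∀ j, k' j = (k j ^^ l j) :=
      ⟨fun j => k j ^^ k' j, fun j => by simp⟩
    rw [hi, hi, hi, hl, hl, hl, hL, hL, hL, ← hxb] at hp
    have hp' : (sgn (i 0) * sgn (i 1) * sgn (i 2)) * ((if l 0 then R 0 else 1) *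
        (if l 1 then R 1 else 1) * (if l 2 then R 2 else 1)) = 1 := by
      apply mul_left_cancel₀ (mul_ne_zero (mul_ne_zero (hx0 0) (hx0 1)) (hx0 2))
      linear_combination hp
    have hε : sgn (i 0) * sgn (i 1) * sgn (i 2) = 1 ∨ sgn (i 0) * sgn (i 1) * sgn (i 2) = -1 := by
      rcases sgn_cases (i 0) with e | e <;> rcases sgn_cases (i 1) with e' | e' <;>
        rcases sgn_cases (i 2) with e'' | e'' <;> simp [e, e', e'']
    have hεε : (sgn (i 0) * sgn (i 1) * sgn (i 2)) * (sgn (i 0) * sgn (i 1) * sgn (i 2)) = 1 := by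
      rcases hε with e | e <;> rw [e] <;> norm_num
    -- Using exactly one or exactly two of the `R_j` would force some `R_j = ±1`, contrary to
    -- `ratio_ne`.
    have hgood : l 1 = l 0 ∧ l 2 = l 0 ∧ sgn (i 0) * sgn (i 1) * sgn (i 2) = 1 := by
      generalize sgn (i 0) * sgn (i 1) * sgn (i 2) = ε at *
      have r0 := hR1 0 ε hε
      have r1 := hR1 1 ε hε
      have r2 := hR1 2 ε hε
      cases h0 : l 0 <;> cases h1 : l 1 <;> cases h2 : l 2 <;>
        simp only [h0, h1, h2, if_true, Bool.false_eq_true, if_false, mul_one, one_mul] at hp'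
      · exact ⟨rfl, rfl, hp'⟩
      · exact absurd (by linear_combination ε * hp' - R 2 * hεε) r2
      · exact absurd (by linear_combination ε * hp' - R 1 * hεε) r1
      · exact absurd (by linear_combination ε * hRprod - R 0 * hp') r0
      · exact absurd (by linear_combination ε * hp' - R 0 * hεε) r0
      · exact absurd (by linear_combination ε * hRprod - R 1 * hp') r1
      · exact absurd (by linear_combination ε * hRprod - R 2 * hp') r2
      · exact ⟨rfl, rfl, by rw [hRprod, mul_one] at hp'; exact hp'⟩
    obtain ⟨l1, l2, hs⟩ := hgood
    refine ⟨(i 0, i 2, l 0), ?_⟩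
    have hi1 := sgn_prod_eq_one hs
    funext j
    fin_cases j
    · simp [f, triple, hi, hl]
    · simp [f, triple, hi, hl, hi1, l1]
    · simp [f, triple, hi, hl, l2]
  · rintro ⟨⟨y, y', y''⟩, rfl⟩
    refine ⟨![s 0 ^^ y, s 1 ^^ (y ^^ y'), s 2 ^^ y'], fun j => k j ^^ y'', ?_, ?_⟩
    · funext j
      fin_cases j <;> rfl
    · simp only [Matrix.cons_val, hL]
      rw [← hxb]
      have e := sgn_prod_xor y y'
      cases y''
      · simp only [Bool.false_eq_true, if_false]
        linear_combination x 0 * x 1 * x 2 * e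
      · simp only [if_true]
        linear_combination x 0 * x 1 * x 2 * R 0 * R 1 * R 2 * e + x 0 * x 1 * x 2 * hRprod

end Counting

/-! ### The main statements -/

section Main

variable {τ : Fin 3 → ℍ}

theorem sing_Xnu {ν₁ ν₂ : ℂ} (h₁ : ν₁ ≠ ν₂) (h₂ : ν₁ ≠ -ν₂)
    (hfree : ActsFreelyOn G₁ (Xnu τ ν₁ ν₂)) : Sing (Xnu τ ν₁ ν₂) = nodesNu τ ν₁ ν₂ := by
  ext p
  rw [(mem_sing_Xnu_iff h₁ h₂ p).1]
  exact ⟨fun ⟨hp, h⟩ => h.resolve_left (hfree.not_two_torsion minusOne_mem_G₁ hp),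
    fun h => ⟨nodesNu_subset_Xnu h, Or.inr h⟩⟩

theorem sing_Xmu {μ : ℂ} (hμ : μ ≠ 0) (hfree : ActsFreelyOn G₂ (Xmu τ μ)) :
    Sing (Xmu τ μ) = ∅ := by
  refine Set.eq_empty_of_forall_notMem fun p hp => ?_
  obtain ⟨hpX, h2⟩ := (mem_sing_Xmu_iff hμ p).1.mp hp
  exact hfree.not_two_torsion minusOne_mem_G₂ hpX h2

theorem sing_Xb_smooth_or_nodes : Sing (Xb τ) = ∅ ∨
    ((Sing (Xb τ)).ncard = 8 ∧ ∀ p ∈ Sing (Xb τ), IsNode (Xb τ) p) :=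
  (Set.eq_empty_or_nonempty _).imp_right fun h =>
    ⟨ncard_sing_Xb h, fun p => (mem_sing_Xmu_iff b_prod_ne_zero p).2⟩

end Main

end Burniat

end

theorem mainTheorem4 (τ : Fin 3 → ℍ) :
    -- the family with parameter `ν = (ν₁ : ν₂)`
    (∀ (ν₁ ν₂ : ℂ) (h₀ : ![ν₁, ν₂] ≠ 0), ν₁ ≠ ν₂ → ν₁ ≠ -ν₂ →
      Burniat.ActsFreelyOn Burniat.G₁ (Burniat.Xnu τ ν₁ ν₂) →
        ((Burniat.Sing (Burniat.Xnu τ ν₁ ν₂)).Nonempty ↔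
          Projectivization.mk ℂ ![ν₁, ν₂] h₀ ∈ Burniat.specialNu (Burniat.b (τ 0))) ∧
        Burniat.Sing (Burniat.Xnu τ ν₁ ν₂) = Burniat.nodesNu τ ν₁ ν₂) ∧
    -- the family with parameter `μ`
    (∀ μ : ℂ, μ ≠ 0 → Burniat.ActsFreelyOn Burniat.G₂ (Burniat.Xmu τ μ) →
        Burniat.Sing (Burniat.Xmu τ μ) = ∅) ∧
    -- the hypersurface with the group `G₃` or `G₄`
    (∀ G : AddSubgroup Burniat.Grp, G = Burniat.G₃ ∨ G = Burniat.G₄ →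
      Burniat.ActsFreelyOn G (Burniat.Xb τ) →
        ((Burniat.Sing (Burniat.Xb τ)).Nonempty ↔
          Burniat.b (τ 0) * Burniat.b (τ 1) * Burniat.b (τ 2) ∈ Burniat.specialB τ) ∧
        Burniat.Sing (Burniat.Xb τ) = {p | p ∈ Burniat.Xb τ ∧ ∀ j, 2 • p j = 0}) ∧
    -- in every case: smooth, or exactly eight nodes
    (∀ (X : Set (Burniat.Torus τ)) (G : AddSubgroup Burniat.Grp), Burniat.IsRegularPair τ X G →
      Burniat.Sing X = ∅ ∨
        ((Burniat.Sing X).ncard = 8 ∧ ∀ p ∈ Burniat.Sing X, Burniat.IsNode X p)) := by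
  refine ⟨fun ν₁ ν₂ h₀ h₁ h₂ hfree => ?_, fun μ hμ hfree => Burniat.sing_Xmu hμ hfree,
    fun G _ _ => ⟨Burniat.sing_Xb_nonempty_iff, Burniat.sing_Xb⟩, ?_⟩
  · rw [Burniat.sing_Xnu h₁ h₂ hfree, Burniat.nodesNu_nonempty_iff, Burniat.mem_specialNu_iff]
    exact ⟨Iff.rfl, rfl⟩
  · rintro X G (⟨ν₁, ν₂, h₀, h₁, h₂, hfree⟩ | ⟨μ, hμ, hfree⟩ | ⟨_⟩ | ⟨_⟩)
    · refine (Set.eq_empty_or_nonempty _).imp_right fun hne => ⟨?_, fun p =>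
        (Burniat.mem_sing_Xnu_iff h₁ h₂ p).2⟩
      rw [Burniat.sing_Xnu h₁ h₂ hfree] at hne ⊢
      exact Burniat.ncard_nodesNu h₀ hne
    · exact Or.inl (Burniat.sing_Xmu hμ hfree)
    · exact Burniat.sing_Xb_smooth_or_nodes
    · exact Burniat.sing_Xb_smooth_or_nodes
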